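/- **Setting.** Let $n_0=k\ge 1$, let $n_1,\dots,n_d$ be integers with $n_i\ge 5n_{i-1}$ for $1\le i\le d$, and put $n=n_d$. For matrices $W_i\in\mathbb R^{n_i\times n_{i-1}}$ let $G(z)=\phi_d(\cdots\phi_1(z)\cdots)$ with $\phi_i(a)=\mathrm{ReLU}(W_ia)$, where $\mathrm{ReLU}(t)=\max\{t,0\}$ is applied coordinatewise. The entries of all the $W_i$ are independent $\mathcal N(0,1)$ random variables. For a matrix $W$ and a set $I$ of row indices, $W_{I,:}$ is the submatrix of the rows in $I$. **Algorithm.** For a matrix $W\in\mathbb R^{N\times p}$ with rows $w_1^\top,\dots,w_N^\top$, a vector $x\in\mathbb R^N$ and $\epsilon\ge 0$, the $\ell_\infty$ linear program $\mathrm{LP}(W,x,\epsilon)$ minimizes $\delta$ over $(z,\delta)\in\mathbb R^p\times\mathbb R$ subject to $$x_j-\delta\le w_j^\top z\le x_j+\delta\ \text{ if } x_j>\epsilon,\qquad w_j^\top z\le x_j+\delta\ \text{ if } x_j\le\epsilon,\qquad \delta\le\epsilon .$$ Given an observation $x\in\mathbb R^n$ with noise level $\epsilon$ and a constant $c_2>0$,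 the layerwise $\ell_\infty$ LP puts $z_d=x$ and, for $i=d,d-1,\dots,1$, takes for $z_{i-1}$ the $z$-part of any optimal solution of $\mathrm{LP}\big(W_i,z_i,(2/c_2)^{d-i}\epsilon\big)$; its output is $z=z_0$. **Statement.** There are absolute constants $c_2\in(0,2]$ and $C,\gamma>0$ such that for all $d$ and all $n_0,\dots,n_d$ as above the following hold. 1. For every $i\in\{1,\dots,d\}$ the matrix $W_i$ extends the $\ell_\infty$ norm on submatrices with constant $c_2$. That is, there is an integer $m$ with $n_{i-1}<m\le \frac25 n_i$ such that, with probability at least $1-Ce^{-\gamma n_{i-1}}$, $$\|(W_i)_{I,:}\,x\|_\infty\ge c_2\|x\|_\infty\quad\text{for all } I\subset\{1,\dots,n_i\} \text{ with } |I|\ge m \text{ and all } x\in\mathbb R^{n_{i-1}};$$ and for each fixed $I\subset\{1,\dots,n_i\}$ with $|I|\ge 2n_{i-1}$, with probability at least $1-Ce^{-\gamma n_{i-1}}$, this inequality holds for all $x\in\mathbb R^{n_{i-1}}$. 2. For every fixed $z^*\in\mathbb R^k$, with probability at least $1-Ce^{-\gamma k}$ the following holds for all $e\in\mathbb R^n$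 (which may depend on the weights) whose norm $\epsilon=\|e\|_\infty$ satisfies $\epsilon<\frac{c_2^d}{2^{d+4}}\|z^*\|_2\sqrt k$: run on the observation $x=G(z^*)+e$, the layerwise $\ell_\infty$ LP meets only linear programs that have an optimal solution, and, whichever optimal solutions it takes, its output $z$ satisfies $\|z-z^*\|_\infty\le \frac{2^d\epsilon}{c_2^d}$. -/

import Mathlib

open MeasureTheory ProbabilityTheory

/-- The layer map `a ↦ ReLU (A a)`, with `ReLU` applied coordinatewise and no bias. -/
def reluLayer {N k : ℕ} (A : Matrix (Fin N) (Fin k) ℝ) (a : Fin k → ℝ) : Fin N → ℝ :=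
  fun j => max ((A.mulVec a) j) 0

/-- The output of the `i`-th layer on the input `z`; `W i` is the weight matrix of the layer that
maps `ℝ^(n i)` to `ℝ^(n (i+1))`. The `d`-layer generator is `netOutput n W z d`. -/
def netOutput (n : ℕ → ℕ) (W : (i : ℕ) → Matrix (Fin (n (i + 1))) (Fin (n i)) ℝ)
    (z : Fin (n 0) → ℝ) : (i : ℕ) → Fin (n i) → ℝ
  | 0 => z
  | i + 1 => reluLayer (W i) (netOutput n W z i)

/-- The entries of the random weight matrices of the first `d` layers are jointly independent
standard Gaussian variables. -/
def IsIIDStdGaussian {Ω : Type*} [MeasurableSpace Ω] (μ : Measure Ω) (d : ℕ) (n : ℕ → ℕ)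
    (W : (i : ℕ) → Ω → Matrix (Fin (n (i + 1))) (Fin (n i)) ℝ) : Prop :=
  (∀ i < d, ∀ (a : Fin (n (i + 1))) (b : Fin (n i)),
      HasLaw (fun ω => W i ω a b) (gaussianReal 0 1) μ) ∧
    iIndepFun
      (fun (p : Σ i : Fin d, Fin (n (i + 1)) × Fin (n i)) (ω : Ω) => W p.1 ω p.2.1 p.2.2) μ

/-- `‖A_I x‖_∞ ≥ c ‖x‖_∞` for all `x`, where `A_I` consists of the rows of `A` with index in `I`.
(The norm of `Fin k → ℝ` and of `I → ℝ` is the sup norm.) -/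
def RowsExtend {N k : ℕ} (A : Matrix (Fin N) (Fin k) ℝ) (I : Finset (Fin N)) (c : ℝ) : Prop :=
  ∀ x : Fin k → ℝ, c * ‖x‖ ≤ ‖(A.submatrix (fun j : I => (j : Fin N)) id).mulVec x‖

/-- Except with probability at most `p`, all submatrices with at least `m` rows extend the sup norm
simultaneously. -/
def AllSubmatricesExtend {Ω : Type*} [MeasurableSpace Ω] (μ : Measure Ω) {N k : ℕ}
    (A : Ω → Matrix (Fin N) (Fin k) ℝ) (m : ℕ) (c p : ℝ) : Prop :=
  μ {ω | ¬ ∀ I : Finset (Fin N), m ≤ I.card → RowsExtend (A ω) I c} ≤ ENNReal.ofReal p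

/-- Each given submatrix with at least `m` rows extends the sup norm, except with probability at
most `p`. -/
def EachSubmatrixExtends {Ω : Type*} [MeasurableSpace Ω] (μ : Measure Ω) {N k : ℕ}
    (A : Ω → Matrix (Fin N) (Fin k) ℝ) (m : ℕ) (c p : ℝ) : Prop :=
  ∀ I : Finset (Fin N), m ≤ I.card → μ {ω | ¬ RowsExtend (A ω) I c} ≤ ENNReal.ofReal p

/-- The constraints of the `ℓ_∞` linear program that inverts one layer, with matrix `A`,
observation `x` and error bound `ε`, in the variables `z` and `δ`. -/
def LPFeasible {N k : ℕ} (A : Matrix (Fin N) (Fin k) ℝ) (x : Fin N → ℝ) (ε : ℝ)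
    (z : Fin k → ℝ) (δ : ℝ) : Prop :=
  (∀ j, ε < x j → x j - δ ≤ (A.mulVec z) j ∧ (A.mulVec z) j ≤ x j + δ) ∧
    (∀ j, x j ≤ ε → (A.mulVec z) j ≤ x j + δ) ∧ δ ≤ ε

/-- `z` is an output of the linear program: together with some `δ` it is feasible and minimizes
`δ` among all feasible pairs. -/
def IsLPSolution {N k : ℕ} (A : Matrix (Fin N) (Fin k) ℝ) (x : Fin N → ℝ) (ε : ℝ)
    (z : Fin k → ℝ) : Prop :=
  ∃ δ, LPFeasible A x ε z δ ∧ ∀ z' δ', LPFeasible A x ε z' δ' → δ ≤ δ'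

/-- `InversionReaches n W x d tol i y`: the layerwise inversion, started from the observation `x` of
the output of layer `d` and using the error bound `tol i` to invert layer `i`, can arrive at the
vector `y` as its reconstruction of the output of layer `i`. (Whenever the linear program of a layer
has several solutions, any of them may be chosen.) -/
inductive InversionReaches (n : ℕ → ℕ) (W : (i : ℕ) → Matrix (Fin (n (i + 1))) (Fin (n i)) ℝ)
    (d : ℕ) (x : Fin (n d) → ℝ) (tol : ℕ → ℝ) : (i : ℕ) → (Fin (n i) → ℝ) → Prop
  | start : InversionReaches n W d x tol d x
  | step {i : ℕ} {y : Fin (n (i + 1)) → ℝ} {z : Fin (n i) → ℝ} :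
      InversionReaches n W d x tol (i + 1) y → IsLPSolution (W i) y (tol (i + 1)) z →
      InversionReaches n W d x tol i z

/-- The layerwise inversion never gets stuck (every linear program that it meets has a solution),
and, whichever solutions are chosen, its final output is within `r` of `zstar` in the sup norm. -/
def InversionRecovers (n : ℕ → ℕ) (W : (i : ℕ) → Matrix (Fin (n (i + 1))) (Fin (n i)) ℝ)
    (d : ℕ) (x : Fin (n d) → ℝ) (tol : ℕ → ℝ) (zstar : Fin (n 0) → ℝ) (r : ℝ) : Prop :=
  (∀ i < d, ∀ y, InversionReaches n W d x tol (i + 1) y →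
      ∃ z, IsLPSolution (W i) y (tol (i + 1)) z) ∧
    ∀ z, InversionReaches n W d x tol 0 z → ‖z - zstar‖ ≤ r

open scoped ENNReal NNReal

/-!
If a random polyhedron `{x | ∀ j, ⟪w_j, x⟫ ≤ b_j}` is nonempty, it contains a point at which at most
`k = dim x` linearly independent constraints are tight. This point is a function of the rows of
these constraints, so the remaining rows are independent trials against a fixed point, and a union
bound over the possible sets of tight constraints bounds the probability of nonemptiness. Fixing one
coordinate of `x` to be `±R` and scaling turns this into a bound on the probability that the
polyhedron reaches outside the ball of radius `R`. Applied to the constraints `|⟪w_j, x⟫| ≤ c ‖x‖`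
it shows that submatrices extend the sup norm.

A Chernoff bound shows that on a nonzero input `y` about two fifths of the outputs of a layer
exceed `‖y‖₂ / 500`. Hence the layers do not shrink the Euclidean norm by more than a constant
factor, the first layer even gains a factor `√k`, and the error bound of each layer but the first is
smaller than half of all these large outputs. The linear program of such a layer constrains the
corresponding rows from both sides, and the extension property gives the error estimate. At the
first layer the error bound may be as large as a multiple of `√k ‖z*‖₂`. If it exceeds
`‖z*‖₂ / 1000`, only the upper constraints are used: after scaling they define a random polyhedron
which is bounded by the same vertex argument, so that every feasible point is close enough to `z*`.
-/

section Vertex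

variable {𝕜 V T : Type*} [Field 𝕜] [LinearOrder 𝕜] [IsStrictOrderedRing 𝕜] [AddCommGroup V]
  [Module 𝕜 V] [Finite T] {f : T → Module.Dual 𝕜 V} {b : T → 𝕜} {x : V}

theorem exists_feasible_tight_ssubset (hx : ∀ t, f t x ≤ b t) {y : V}
    (hy : ∀ s, f s x = b s → f s y = 0) {t : T} (ht : 0 < f t y) :
    ∃ x', (∀ s, f s x' ≤ b s) ∧ {s | f s x = b s} ⊂ {s | f s x' = b s} := by
  obtain ⟨s₀, hs₀ : 0 < f s₀ y, hmin⟩ := (Set.toFinite {s | 0 < f s y}).exists_minimalFor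
    (fun s => (b s - f s x) / f s y) _ ⟨t, ht⟩
  set r := (b s₀ - f s₀ x) / f s₀ y with hr
  have hr₀ : 0 ≤ r := div_nonneg (sub_nonneg.2 (hx s₀)) hs₀.le
  refine ⟨x + r • y, fun s => ?_, fun s hs => ?_, fun h => hs₀.ne' (hy s₀ (h ?_))⟩
  · rw [map_add, map_smul, smul_eq_mul]
    rcases le_or_gt (f s y) 0 with hsy | hsy
    · exact (add_le_of_nonpos_right (mul_nonpos_of_nonneg_of_nonpos hr₀ hsy)).trans (hx s)
    · have hrs : r ≤ (b s - f s x) / f s y := le_of_not_gt fun hlt => hlt.not_ge (hmin hsy hlt.le)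
      linarith [(le_div_iff₀ hsy).1 hrs]
  · simp only [Set.mem_ofPred_eq, map_add, map_smul, hy s hs, smul_zero, add_zero] at hs ⊢
    exact hs
  · simp only [Set.mem_ofPred_eq, map_add, map_smul, smul_eq_mul, hr,
      div_mul_cancel₀ _ hs₀.ne', add_sub_cancel]

theorem exists_feasible_forall_mem_span_tight (hx : ∀ t, f t x ≤ b t) :
    ∃ x', (∀ t, f t x' ≤ b t) ∧
      ∀ t, f t ∈ Submodule.span 𝕜 (f '' {s | f s x' = b s}) := by
  obtain ⟨x', hx', hmax⟩ := (Set.toFinite ((fun x => {s | f s x = b s}) ''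
    {x | ∀ t, f t x ≤ b t})).exists_maximal ⟨_, x, hx, rfl⟩
  obtain ⟨x', hx', rfl⟩ := hx'
  refine ⟨x', hx', fun t => ?_⟩
  rw [Set.image_eq_range]
  refine mem_span_of_iInf_ker_le_ker fun y hy => ?_
  by_contra hty
  obtain ⟨y, hy, hty⟩ : ∃ y, (∀ s, f s x' = b s → f s y = 0) ∧ 0 < f t y := by
    have hy' : ∀ s, f s x' = b s → f s y = 0 := by simpa using hy
    rcases lt_or_gt_of_ne (show f t y ≠ 0 from hty) with hneg | hpos
    · exact ⟨-y, fun s hs => by simp [hy' s hs], by simpa using hneg⟩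
    · exact ⟨y, hy', hpos⟩
  obtain ⟨x'', hx'', hss⟩ := exists_feasible_tight_ssubset hx' hy hty
  exact hss.2 (hmax ⟨x'', hx'', rfl⟩ hss.1)

theorem exists_linearIndependent_forall_eq_imp_feasible (hx : ∀ t, f t x ≤ b t) :
    ∃ K : Finset T, LinearIndependent 𝕜 (fun t : K => f t) ∧
      ∀ v, (∀ t ∈ K, f t v = b t) → ∀ t, f t v ≤ b t := by
  obtain ⟨x', hx', hspan⟩ := exists_feasible_forall_mem_span_tight hx
  obtain ⟨K, hKtight, -, hKspan, hK⟩ := exists_linearIndepOn_extension (K := 𝕜) (v := f)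
    (linearIndepOn_empty 𝕜 f) (Set.empty_subset {s | f s x' = b s})
  lift K to Finset T using K.toFinite
  refine ⟨K, hK, fun v hv t => ?_⟩
  have hagree : Set.EqOn (Module.Dual.eval 𝕜 V v) (Module.Dual.eval 𝕜 V x') (f '' K) := by
    rintro _ ⟨s, hs, rfl⟩
    exact (hv s hs).trans (hKtight hs).symm
  have ht : f t v = f t x' :=
    LinearMap.eqOn_span hagree (Submodule.span_le.2 hKspan (hspan t))
  exact ht.trans_le (hx' t)

end Vertex

section MinNormSolution

variable {m ι : Type*} [Fintype m] [DecidableEq m] [Fintype ι]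

/-- The minimum norm solution `Aᵀ (A Aᵀ)⁻¹ b` of the linear system `A v = b`, for a matrix `A` with
linearly independent rows. It serves as a measurable choice of a solution. -/
noncomputable def minNormSolution (A : Matrix m ι ℝ) (b : m → ℝ) : ι → ℝ :=
  A.transpose.mulVec ((A * A.transpose)⁻¹.mulVec b)

theorem mulVec_minNormSolution {A : Matrix m ι ℝ} (hA : LinearIndependent ℝ A.row) (b : m → ℝ) :
    A.mulVec (minNormSolution A b) = b := by
  have hunit : IsUnit (A * A.transpose) :=
    (Matrix.PosDef.mul_conjTranspose_self A (Matrix.vecMul_injective_iff.2 hA)).isUnit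
  rw [minNormSolution, Matrix.mulVec_mulVec, Matrix.mulVec_mulVec,
    Matrix.mul_nonsing_inv _ ((Matrix.isUnit_iff_isUnit_det _).1 hunit), Matrix.one_mulVec]

variable {α : Type*} [MeasurableSpace α]

theorem measurable_matrix_inv_apply {G : α → Matrix m m ℝ}
    (hG : ∀ i j, Measurable fun a => G a i j) (i j : m) :
    Measurable fun a => (G a)⁻¹ i j := by
  have hG' : Measurable (fun a i j => G a i j) := by fun_prop
  have hdet : Measurable fun M : m → m → ℝ => (Matrix.of M).det :=
    (continuous_id.matrix_det (A := fun M : m → m → ℝ => Matrix.of M)).measurable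
  have hadj : Measurable fun M : m → m → ℝ => (Matrix.of M).adjugate i j :=
    ((continuous_id.matrix_adjugate (A := fun M : m → m → ℝ => Matrix.of M)).matrix_elem
      i j).measurable
  simp only [Matrix.inv_def, Ring.inverse_eq_inv', Matrix.smul_apply, smul_eq_mul]
  exact (hdet.comp hG').inv.mul (hadj.comp hG')

theorem measurable_minNormSolution {A : α → Matrix m ι ℝ} {b : α → m → ℝ}
    (hA : ∀ t l, Measurable fun a => A a t l) (hb : ∀ t, Measurable fun a => b a t) :
    Measurable fun a => minNormSolution (A a) (b a) := by
  have hinv := measurable_matrix_inv_apply (G := fun a => A a * (A a).transpose) fun t t' => by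
    simp only [Matrix.mul_apply, Matrix.transpose_apply]
    fun_prop
  refine measurable_pi_iff.2 fun l => ?_
  exact Finset.measurable_fun_sum _ fun t _ => (hA t l).mul <|
    Finset.measurable_fun_sum _ fun t' _ => (hinv t t').mul (hb t')

end MinNormSolution

section ProductMeasure

theorem prod_le_of_forall_section_le {α β : Type*} [MeasurableSpace α] [MeasurableSpace β]
    (μ : Measure α) [IsProbabilityMeasure μ] (ν : Measure β) {s : Set (α × β)}
    (hs : MeasurableSet s) {p : ℝ≥0∞} (hp : ∀ x, ν (Prod.mk x ⁻¹' s) ≤ p) : μ.prod ν s ≤ p :=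
  (Measure.prod_apply_le hs).trans <| (lintegral_mono hp).trans_eq <| by
    rw [lintegral_const, measure_univ, mul_one]

theorem pi_forall_notMem_le {J E V : Type*} [Fintype J] [MeasurableSpace E] [MeasurableSpace V]
    (ν : Measure E) [IsProbabilityMeasure ν] (I : Finset J) {v : (I → E) → V}
    (hv : Measurable v) {S : Set (V × E)} (hS : MeasurableSet S) {p : ℝ≥0∞}
    (hp : ∀ y, ν {w | (y, w) ∈ S} ≤ p) :
    Measure.pi (fun _ : J => ν) {W | ∀ j ∉ I, (v (fun j : I => W j), W j) ∈ S} ≤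
      p ^ (Fintype.card J - I.card) := by
  classical
  let B : Set ((I → E) × ({j // j ∉ I} → E)) := {q | ∀ j, (v q.1, q.2 j) ∈ S}
  have hB : MeasurableSet B := by
    rw [show B = ⋂ j, {q | (v q.1, q.2 j) ∈ S} from Set.ofPred_forall _]
    exact MeasurableSet.iInter fun j =>
      ((hv.comp measurable_fst).prodMk ((measurable_pi_apply j).comp measurable_snd)) hS
  have hpre : {W : J → E | ∀ j ∉ I, (v (fun j : I => W j), W j) ∈ S} =
      MeasurableEquiv.piEquivPiSubtypeProd (fun _ : J => E) (· ∈ I) ⁻¹' B := by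
    ext W
    exact ⟨fun hW j => hW j j.2, fun hW j hj => hW ⟨j, hj⟩⟩
  rw [hpre, (measurePreserving_piEquivPiSubtypeProd (fun _ : J => ν) (· ∈ I)).measure_preimage
    hB.nullMeasurableSet]
  refine prod_le_of_forall_section_le _ _ hB fun y => ?_
  have hsection : Prod.mk y ⁻¹' B = Set.univ.pi fun _ => {w | (v y, w) ∈ S} := by
    ext q
    simp [B]
  rw [hsection, Measure.pi_pi, Finset.prod_const, Finset.card_univ, Fintype.card_subtype_compl,
    Fintype.card_coe]
  exact pow_le_pow_left' (hp _) _

end ProductMeasure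

theorem exists_abs_apply_eq_norm {ι : Type*} [Fintype ι] {x : ι → ℝ} (hx : x ≠ 0) :
    ∃ i, |x i| = ‖x‖ := by
  obtain ⟨i₀, -⟩ := Function.ne_iff.1 hx
  have : Nonempty ι := ⟨i₀⟩
  obtain ⟨i, hi⟩ := Finite.exists_max fun i => |x i|
  exact ⟨i, (norm_le_pi_norm x i).antisymm ((pi_norm_le_iff_of_nonneg (abs_nonneg _)).2 hi)⟩

section RandomPolyhedron

variable {J S E ι : Type*} [Fintype ι]

/-- The point at which the constraints `a (σ t) (w t) ⬝ᵥ v ≤ b (σ t) (w t)` hold with equality, if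
their coefficient vectors are linearly independent. -/
noncomputable def tightPoint {m : Type*} [Fintype m] [DecidableEq m] (a : S → E → ι → ℝ)
    (b : S → E → ℝ) (σ : m → S) (w : m → E) : ι → ℝ :=
  minNormSolution (Matrix.of fun t => a (σ t) (w t)) fun t => b (σ t) (w t)

theorem exists_tightPoint_feasible [Finite J] [Finite S] [DecidableEq J] [DecidableEq S]
    (a : S → E → ι → ℝ) (b : S → E → ℝ) {W : J → E} {x : ι → ℝ}
    (hx : ∀ j σ, a σ (W j) ⬝ᵥ x ≤ b σ (W j)) :
    ∃ K : Finset (J × S), K.card ≤ Fintype.card ι ∧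
      ∀ j σ, a σ (W j) ⬝ᵥ tightPoint a b (fun t : K => t.1.2) (fun t => W t.1.1) ≤ b σ (W j) := by
  classical
  obtain ⟨K, hK, hall⟩ := exists_linearIndependent_forall_eq_imp_feasible
    (f := fun t : J × S => dotProductEquiv ℝ ι (a t.2 (W t.1))) (b := fun t => b t.2 (W t.1))
    (x := x) fun t => hx t.1 t.2
  have hrows : LinearIndependent ℝ fun t : K => a t.1.2 (W t.1.1) :=
    LinearIndependent.of_comp (dotProductEquiv ℝ ι).toLinearMap hK
  refine ⟨K, by simpa using hrows.fintype_card_le_finrank,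
    fun j σ => hall _ (fun t ht => ?_) (j, σ)⟩
  exact congrFun (mulVec_minNormSolution (A := Matrix.of fun t : K => a t.1.2 (W t.1.1)) hrows _)
    ⟨t, ht⟩

theorem dotProduct_eq_add_dotProduct_subtype_ne [DecidableEq ι] (i : ι) (u x : ι → ℝ) :
    u ⬝ᵥ x = u i * x i + (fun l : {l // l ≠ i} => u l) ⬝ᵥ fun l => x l :=
  Fintype.sum_eq_add_sum_subtype_ne (fun l => u l * x l) i

variable [MeasurableSpace E]

theorem measurable_tightPoint {m : Type*} [Fintype m] [DecidableEq m] {a : S → E → ι → ℝ}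
    {b : S → E → ℝ} (ha : ∀ σ, Measurable (a σ)) (hb : ∀ σ, Measurable (b σ)) (σ : m → S) :
    Measurable (tightPoint a b σ) :=
  measurable_minNormSolution
    (fun t l => (measurable_pi_apply l).comp ((ha _).comp (measurable_pi_apply t)))
    fun t => (hb _).comp (measurable_pi_apply t)

variable [Fintype J] [Fintype S] (ν : Measure E) [IsProbabilityMeasure ν] {a : S → E → ι → ℝ}
  {b : S → E → ℝ} {p : ℝ≥0∞}

/-- A nonempty polyhedron contains the `tightPoint` of some set of at most `card ι` constraints.
This point depends on these rows only, so that the other rows are independent trials against it. -/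
theorem pi_exists_feasible_le (ha : ∀ σ, Measurable (a σ)) (hb : ∀ σ, Measurable (b σ))
    (hp₁ : p ≤ 1) (hp : ∀ v, ν {w | ∀ σ, a σ w ⬝ᵥ v ≤ b σ w} ≤ p) :
    Measure.pi (fun _ : J => ν) {W | ∃ x, ∀ j σ, a σ (W j) ⬝ᵥ x ≤ b σ (W j)} ≤
      ∑ K : Finset (J × S) with K.card ≤ Fintype.card ι, p ^ (Fintype.card J - K.card) := by
  classical
  let vertex (K : Finset (J × S)) (y : K.image Prod.fst → E) : ι → ℝ :=
    tightPoint a b (fun t : K => t.1.2) fun t => y ⟨t.1.1, Finset.mem_image_of_mem _ t.2⟩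
  let R : Set ((ι → ℝ) × E) := {q | ∀ σ, a σ q.2 ⬝ᵥ q.1 ≤ b σ q.2}
  let event (K : Finset (J × S)) : Set (J → E) :=
    {W | ∀ j ∉ K.image Prod.fst, (vertex K (fun j => W j), W j) ∈ R}
  have hvertex (K) : Measurable (vertex K) := (measurable_tightPoint ha hb _).comp (by fun_prop)
  have hR : MeasurableSet R := by
    rw [show R = ⋂ σ, {q | a σ q.2 ⬝ᵥ q.1 ≤ b σ q.2} from Set.ofPred_forall _]
    refine MeasurableSet.iInter fun σ => measurableSet_le ?_ ((hb σ).comp measurable_snd)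
    unfold dotProduct
    fun_prop
  have hcover : {W : J → E | ∃ x, ∀ j σ, a σ (W j) ⬝ᵥ x ≤ b σ (W j)} ⊆
      ⋃ K ∈ Finset.univ.filter fun K : Finset (J × S) => K.card ≤ Fintype.card ι, event K := by
    rintro W ⟨x, hx⟩
    obtain ⟨K, hcard, hK⟩ := exists_tightPoint_feasible a b hx
    exact Set.mem_biUnion (by simpa using hcard) fun j _ => hK j
  calc _ ≤ ∑ K : Finset (J × S) with K.card ≤ Fintype.card ι,
          Measure.pi (fun _ : J => ν) (event K) :=
        (measure_mono hcover).trans (measure_biUnion_finset_le _ _)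
    _ ≤ _ := Finset.sum_le_sum fun K _ =>
        (pi_forall_notMem_le ν (K.image Prod.fst) (hvertex K) hR hp).trans
          (pow_le_pow_right_of_le_one' hp₁ (Nat.sub_le_sub_left Finset.card_image_le _))

theorem pi_exists_feasible_apply_eq_le (ha : ∀ σ, Measurable (a σ)) (hb : ∀ σ, Measurable (b σ))
    (hp₁ : p ≤ 1) (i : ι) (ρ : ℝ) (hp : ∀ v, v i = ρ → ν {w | ∀ σ, a σ w ⬝ᵥ v ≤ b σ w} ≤ p) :
    Measure.pi (fun _ : J => ν) {W | ∃ x, x i = ρ ∧ ∀ j σ, a σ (W j) ⬝ᵥ x ≤ b σ (W j)} ≤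
      ∑ K : Finset (J × S) with K.card < Fintype.card ι, p ^ (Fintype.card J - K.card) := by
  classical
  let a' (σ : S) (w : E) (l : {l // l ≠ i}) : ℝ := a σ w l
  let b' (σ : S) (w : E) : ℝ := b σ w - a σ w i * ρ
  have hiff {x : ι → ℝ} (hx : x i = ρ) (σ : S) (w : E) :
      a σ w ⬝ᵥ x ≤ b σ w ↔ a' σ w ⬝ᵥ (fun l => x l) ≤ b' σ w := by
    rw [dotProduct_eq_add_dotProduct_subtype_ne i, hx, ← le_sub_iff_add_le']
  have hslice (v : {l // l ≠ i} → ℝ) : ν {w | ∀ σ, a' σ w ⬝ᵥ v ≤ b' σ w} ≤ p := by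
    let x (l : ι) : ℝ := if h : l = i then ρ else v ⟨l, h⟩
    have hxi : x i = ρ := dif_pos rfl
    have hxv : (fun l : {l // l ≠ i} => x l) = v := funext fun l => dif_neg l.2
    simpa only [hiff hxi, hxv] using hp x hxi
  have hcard (K : Finset (J × S)) :
      K.card < Fintype.card ι ↔ K.card ≤ Fintype.card {l // l ≠ i} := by
    rw [Fintype.card_subtype_compl, Fintype.card_subtype_eq]
    exact Nat.lt_iff_le_pred (Fintype.card_pos_iff.2 ⟨i⟩)
  simp only [hcard]
  refine (measure_mono ?_).trans
    (pi_exists_feasible_le ν (a := a') (b := b') (by fun_prop) (by fun_prop) hp₁ hslice)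
  rintro W ⟨x, hxi, hx⟩
  exact ⟨fun l => x l, fun j σ => (hiff hxi σ (W j)).1 (hx j σ)⟩

theorem pi_exists_feasible_norm_ge_le (ha : ∀ σ, Measurable (a σ)) (hb : ∀ σ, Measurable (b σ))
    (hp₁ : p ≤ 1) (hb₀ : ∀ σ w, 0 ≤ b σ w) {R : ℝ} (hR : 0 < R)
    (hp : ∀ v, R ≤ ‖v‖ → ν {w | ∀ σ, a σ w ⬝ᵥ v ≤ b σ w} ≤ p) :
    Measure.pi (fun _ : J => ν) {W | ∃ x, R ≤ ‖x‖ ∧ ∀ j σ, a σ (W j) ⬝ᵥ x ≤ b σ (W j)} ≤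
      2 * Fintype.card ι *
        ∑ K : Finset (J × S) with K.card < Fintype.card ι, p ^ (Fintype.card J - K.card) := by
  let slice (i : ι) (ρ : ℝ) : Set (J → E) :=
    {W | ∃ x, x i = ρ ∧ ∀ j σ, a σ (W j) ⬝ᵥ x ≤ b σ (W j)}
  set B := ∑ K : Finset (J × S) with K.card < Fintype.card ι, p ^ (Fintype.card J - K.card)
  have hslice (i : ι) {ρ : ℝ} (hρ : |ρ| = R) : Measure.pi (fun _ : J => ν) (slice i ρ) ≤ B :=
    pi_exists_feasible_apply_eq_le ν ha hb hp₁ i ρ fun v hv =>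
      hp v (by rw [← hρ, ← hv]; exact norm_le_pi_norm v i)
  have hcover : {W : J → E | ∃ x, R ≤ ‖x‖ ∧ ∀ j σ, a σ (W j) ⬝ᵥ x ≤ b σ (W j)} ⊆
      ⋃ i, (slice i R ∪ slice i (-R)) := by
    rintro W ⟨x, hxR, hx⟩
    have hx₀ : 0 < ‖x‖ := hR.trans_le hxR
    obtain ⟨i, hi⟩ := exists_abs_apply_eq_norm (norm_pos_iff.1 hx₀)
    have hfeasible (j σ) : a σ (W j) ⬝ᵥ (R / ‖x‖) • x ≤ b σ (W j) := by
      rw [dotProduct_smul, smul_eq_mul]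
      calc R / ‖x‖ * (a σ (W j) ⬝ᵥ x) ≤ R / ‖x‖ * b σ (W j) := by gcongr; exact hx j σ
        _ ≤ b σ (W j) := mul_le_of_le_one_left (hb₀ _ _) ((div_le_one hx₀).2 hxR)
    refine Set.mem_iUnion.2 ⟨i, ?_⟩
    rcases abs_choice (x i) with hxi | hxi <;> rw [hi] at hxi
    · exact Or.inl ⟨_, by simp [← hxi, hx₀.ne'], hfeasible⟩
    · exact Or.inr ⟨_, by simp [← neg_eq_iff_eq_neg.2 hxi, hx₀.ne'], hfeasible⟩
  calc _ ≤ ∑ i, Measure.pi (fun _ : J => ν) (slice i R ∪ slice i (-R)) :=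
        (measure_mono hcover).trans (measure_iUnion_fintype_le _ _)
    _ ≤ ∑ _ : ι, (B + B) := Finset.sum_le_sum fun i _ => (measure_union_le _ _).trans
        (add_le_add (hslice i (abs_of_pos hR)) (hslice i ((abs_neg R).trans (abs_of_pos hR))))
    _ = 2 * Fintype.card ι * B := by
        rw [Finset.sum_const, Finset.card_univ, nsmul_eq_mul]
        ring

end RandomPolyhedron

section Counting

variable {T : Type*} [Fintype T] {p : ℝ≥0∞}

theorem sum_card_lt_pow_sub_card_le (hp : p ≤ 1) (N k : ℕ) :
    ∑ K : Finset T with K.card < k, p ^ (N - K.card) ≤ 2 ^ Fintype.card T * p ^ (N - k) := by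
  calc ∑ K : Finset T with K.card < k, p ^ (N - K.card)
      ≤ ∑ K : Finset T with K.card < k, p ^ (N - k) := Finset.sum_le_sum fun K hK =>
        pow_le_pow_right_of_le_one' hp (Nat.sub_le_sub_left (Finset.mem_filter.1 hK).2.le N)
    _ ≤ ∑ _ : Finset T, p ^ (N - k) := Finset.sum_le_sum_of_subset (Finset.filter_subset _ _)
    _ = 2 ^ Fintype.card T * p ^ (N - k) := by
        rw [Finset.sum_const, Finset.card_univ, Fintype.card_finset, nsmul_eq_mul, Nat.cast_pow,
          Nat.cast_ofNat]

theorem sum_card_lt_pow_card_sub_card_le {q : ℝ≥0∞} (hq₀ : q ≠ 0) (hq₁ : q ≤ 1) (k : ℕ) :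
    ∑ K : Finset T with K.card < k, p ^ (Fintype.card T - K.card) ≤
      q⁻¹ ^ k * (q + p) ^ Fintype.card T := by
  calc ∑ K : Finset T with K.card < k, p ^ (Fintype.card T - K.card)
      ≤ ∑ K : Finset T with K.card < k,
          q⁻¹ ^ k * (q ^ K.card * p ^ (Fintype.card T - K.card)) := by
        refine Finset.sum_le_sum fun K hK => ?_
        have hone : 1 ≤ q⁻¹ ^ k * q ^ K.card := by
          calc (1 : ℝ≥0∞) = q⁻¹ ^ k * q ^ k := by
                rw [← mul_pow, ENNReal.inv_mul_cancel hq₀ (ne_top_of_le_ne_top (by simp) hq₁),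
                  one_pow]
            _ ≤ q⁻¹ ^ k * q ^ K.card := mul_le_mul' le_rfl <|
                pow_le_pow_right_of_le_one' hq₁ (Finset.mem_filter.1 hK).2.le
        rw [← mul_assoc]
        exact le_mul_of_one_le_left' hone
    _ ≤ ∑ K : Finset T, q⁻¹ ^ k * (q ^ K.card * p ^ (Fintype.card T - K.card)) :=
        Finset.sum_le_sum_of_subset (Finset.filter_subset _ _)
    _ = q⁻¹ ^ k * (q + p) ^ Fintype.card T := by
        rw [← Finset.mul_sum, Fintype.sum_pow_mul_eq_add_pow]

end Counting

section Gaussian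

theorem gaussianReal_Icc_le {s : ℝ≥0} (hs : s ≠ 0) (a b : ℝ) :
    gaussianReal 0 (s ^ 2) (Set.Icc a b) ≤ ENNReal.ofReal ((b - a) / (2 * s)) := by
  have : (0 : ℝ) < s := NNReal.coe_pos.2 hs.bot_lt
  have hpdf (x : ℝ) : gaussianPDF 0 (s ^ 2) x ≤ ENNReal.ofReal (1 / (2 * s)) := by
    refine ENNReal.ofReal_le_ofReal ?_
    have hexp : Real.exp (-(x - 0) ^ 2 / (2 * (s ^ 2 : ℝ≥0))) ≤ 1 :=
      Real.exp_le_one_iff.2 (div_nonpos_of_nonpos_of_nonneg (by nlinarith) (by positivity))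
    have hsqrt : 2 * (s : ℝ) ≤ √(2 * Real.pi * ((s ^ 2 : ℝ≥0) : ℝ)) := by
      apply Real.le_sqrt_of_sq_le
      push_cast
      nlinarith [Real.pi_gt_three, sq_nonneg (s : ℝ)]
    calc gaussianPDFReal 0 (s ^ 2) x ≤ (√(2 * Real.pi * ((s ^ 2 : ℝ≥0) : ℝ)))⁻¹ * 1 :=
          mul_le_mul_of_nonneg_left hexp (by positivity)
      _ ≤ 1 / (2 * s) := by
          rw [mul_one, one_div]
          exact inv_anti₀ (by positivity) hsqrt
  calc gaussianReal 0 (s ^ 2) (Set.Icc a b) = ∫⁻ x in Set.Icc a b, gaussianPDF 0 (s ^ 2) x :=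
        gaussianReal_apply 0 (pow_ne_zero 2 hs) _
    _ ≤ ∫⁻ _ in Set.Icc a b, ENNReal.ofReal (1 / (2 * s)) := lintegral_mono fun x => hpdf x
    _ = ENNReal.ofReal ((b - a) / (2 * s)) := by
        rw [setLIntegral_const, Real.volume_Icc, ← ENNReal.ofReal_mul (by positivity)]
        ring_nf

theorem gaussianReal_Iio_zero_le (v : ℝ≥0) : gaussianReal 0 v (Set.Iio 0) ≤ 1 / 2 := by
  have hsymm : gaussianReal 0 v (Set.Ioi 0) = gaussianReal 0 v (Set.Iio 0) := by
    conv_lhs => rw [← neg_zero, ← gaussianReal_map_neg]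
    rw [Measure.map_apply measurable_neg measurableSet_Ioi]
    simp
  have hsum : gaussianReal 0 v (Set.Iio 0) + gaussianReal 0 v (Set.Ioi 0) ≤ 1 := by
    rw [← measure_union ((Set.Iio_disjoint_Ici le_rfl).mono_right
      Set.Ioi_subset_Ici_self) measurableSet_Ioi]
    exact prob_le_one
  rw [hsymm, ← two_mul] at hsum
  rwa [ENNReal.le_div_iff_mul_le (by simp) (by simp), mul_comm]

theorem gaussianReal_Iic_le {s : ℝ≥0} (hs : s ≠ 0) {a : ℝ} (ha : 0 ≤ a) :
    gaussianReal 0 (s ^ 2) (Set.Iic a) ≤ ENNReal.ofReal (1 / 2 + a / (2 * s)) := by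
  rw [← Set.Iio_union_Icc_eq_Iic ha, ENNReal.ofReal_add (by norm_num) (by positivity)]
  refine (measure_union_le _ _).trans (add_le_add ?_ ?_)
  · simpa using gaussianReal_Iio_zero_le (s ^ 2)
  · simpa using gaussianReal_Icc_le hs 0 a

theorem gaussianReal_Ioi_le (v : ℝ≥0) {K : ℝ} (hK : 0 < K) :
    gaussianReal 0 v (Set.Ioi K) ≤ ENNReal.ofReal (v / K ^ 2) := by
  have hchebyshev := meas_ge_le_variance_div_sq (μ := gaussianReal 0 v) (X := id)
    (memLp_id_gaussianReal' 2 (by simp)) hK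
  rw [variance_id_gaussianReal] at hchebyshev
  refine (measure_mono fun x (hx : K < x) => ?_).trans hchebyshev
  simpa using hx.le.trans (le_abs_self x)

variable {ι : Type*} [Fintype ι]

/-- The law of a vector with independent standard Gaussian entries; the weight matrix of a layer has
independent rows with this law. -/
noncomputable abbrev gaussianRow (ι : Type*) [Fintype ι] : Measure (ι → ℝ) :=
  Measure.pi fun _ => gaussianReal 0 1

theorem hasLaw_dotProduct_gaussianRow (v : ι → ℝ) :
    HasLaw (fun w => w ⬝ᵥ v) (gaussianReal 0 (‖WithLp.toLp 2 v‖₊ ^ 2)) (gaussianRow ι) := by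
  let L : StrongDual ℝ (EuclideanSpace ℝ ι) := innerSL ℝ (WithLp.toLp 2 v)
  have hL : (fun w : ι → ℝ => w ⬝ᵥ v) = L ∘ WithLp.toLp 2 := by
    ext w
    simp [L, EuclideanSpace.inner_toLp_toLp]
  refine ⟨(by rw [hL]; fun_prop), ?_⟩
  rw [hL, ← Measure.map_map (by fun_prop) (by fun_prop), map_pi_eq_stdGaussian,
    IsGaussian.map_eq_gaussianReal, integral_strongDual_stdGaussian, variance_dual_stdGaussian]
  congr 1
  rw [innerSL_apply_norm, Real.toNNReal_pow (norm_nonneg _), norm_toNNReal]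

theorem gaussianRow_dotProduct_mem (v : ι → ℝ) {s : Set ℝ} (hs : MeasurableSet s) :
    gaussianRow ι {w | w ⬝ᵥ v ∈ s} = gaussianReal 0 (‖WithLp.toLp 2 v‖₊ ^ 2) s := by
  rw [← (hasLaw_dotProduct_gaussianRow v).map_eq,
    Measure.map_apply_of_aemeasurable (hasLaw_dotProduct_gaussianRow v).aemeasurable hs]
  rfl

theorem norm_le_norm_toLp_two (v : ι → ℝ) : ‖v‖ ≤ ‖WithLp.toLp 2 v‖ :=
  (pi_norm_le_iff_of_nonneg (norm_nonneg _)).2 fun i => PiLp.norm_apply_le (WithLp.toLp 2 v) i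

theorem gaussianRow_abs_dotProduct_le {v : ι → ℝ} (hv : 1 ≤ ‖v‖) {c : ℝ} (hc : 0 ≤ c) :
    gaussianRow ι {w | |w ⬝ᵥ v| ≤ c} ≤ ENNReal.ofReal c := by
  have hnorm : 1 ≤ ‖WithLp.toLp 2 v‖ := hv.trans (norm_le_norm_toLp_two v)
  have hne : ‖WithLp.toLp 2 v‖₊ ≠ 0 := fun h => by
    rw [show ‖WithLp.toLp 2 v‖ = 0 from congrArg NNReal.toReal h] at hnorm
    linarith
  simp only [abs_le, ← Set.mem_Icc]
  rw [gaussianRow_dotProduct_mem v measurableSet_Icc]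
  refine (gaussianReal_Icc_le hne (-c) c).trans (ENNReal.ofReal_le_ofReal ?_)
  rw [div_le_iff₀ (by positivity), coe_nnnorm]
  nlinarith

theorem gaussianRow_dotProduct_le {v : ι → ℝ} (hv : v ≠ 0) {a : ℝ} (ha : 0 ≤ a) :
    gaussianRow ι {w | w ⬝ᵥ v ≤ a} ≤ ENNReal.ofReal (1 / 2 + a / (2 * ‖WithLp.toLp 2 v‖)) :=
  (gaussianRow_dotProduct_mem v measurableSet_Iic).trans_le
    (gaussianReal_Iic_le (by simpa using hv) ha)

theorem gaussianRow_lt_dotProduct_le (v : ι → ℝ) {K : ℝ} (hK : 0 < K) :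
    gaussianRow ι {w | K < w ⬝ᵥ v} ≤ ENNReal.ofReal (‖WithLp.toLp 2 v‖ ^ 2 / K ^ 2) :=
  (gaussianRow_dotProduct_mem v measurableSet_Ioi).trans_le (gaussianReal_Ioi_le _ hK)

/-- A radius such that the ball around `0` contains, with high probability, the polyhedron
`{v | ∀ j, w_j ⬝ᵥ v ≤ 2 + (w_j ⬝ᵥ u)₊}` of a Gaussian matrix with rows `w_j`, for a given `u` of
Euclidean norm at most `1000`. -/
noncomputable def feasibleRadius : ℝ := 2000000

theorem gaussianRow_dotProduct_le_two_add_relu_le {u v : ι → ℝ} (hu : ‖WithLp.toLp 2 u‖ ≤ 1000)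
    (hv : feasibleRadius ≤ ‖v‖) :
    gaussianRow ι {w | w ⬝ᵥ v ≤ 2 + max (w ⬝ᵥ u) 0} ≤ ENNReal.ofReal (13 / 25) := by
  have hsub : {w : ι → ℝ | w ⬝ᵥ v ≤ 2 + max (w ⬝ᵥ u) 0} ⊆
      {w | 10000 < w ⬝ᵥ u} ∪ {w | w ⬝ᵥ v ≤ 10002} := by
    intro w (hw : w ⬝ᵥ v ≤ 2 + max (w ⬝ᵥ u) 0)
    rcases lt_or_ge 10000 (w ⬝ᵥ u) with hwu | hwu
    · exact Or.inl hwu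
    · exact Or.inr (by change w ⬝ᵥ v ≤ 10002; linarith [max_le hwu (by norm_num : (0 : ℝ) ≤ 10000)])
  have hnorm : 2000000 ≤ ‖WithLp.toLp 2 v‖ := hv.trans (norm_le_norm_toLp_two v)
  have hv₀ : v ≠ 0 := norm_pos_iff.1 (lt_of_lt_of_le (by norm_num [feasibleRadius]) hv)
  have hlarge : ‖WithLp.toLp 2 u‖ ^ 2 / 10000 ^ 2 ≤ 1 / 100 := by
    rw [div_le_iff₀ (by norm_num)]
    nlinarith [norm_nonneg (WithLp.toLp 2 u)]
  have hsmall : (10002 : ℝ) / (2 * ‖WithLp.toLp 2 v‖) ≤ 1 / 100 := by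
    rw [div_le_iff₀ (by positivity)]
    linarith
  calc _ ≤ gaussianRow ι {w | 10000 < w ⬝ᵥ u} + gaussianRow ι {w | w ⬝ᵥ v ≤ 10002} :=
        (measure_mono hsub).trans (measure_union_le _ _)
    _ ≤ ENNReal.ofReal (‖WithLp.toLp 2 u‖ ^ 2 / 10000 ^ 2) +
          ENNReal.ofReal (1 / 2 + 10002 / (2 * ‖WithLp.toLp 2 v‖)) := by
        gcongr
        · exact gaussianRow_lt_dotProduct_le u (by norm_num)
        · exact gaussianRow_dotProduct_le hv₀ (by norm_num)
    _ ≤ ENNReal.ofReal (13 / 25) := by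
        rw [← ENNReal.ofReal_add (by positivity) (by positivity)]
        exact ENNReal.ofReal_le_ofReal (by linarith)

variable {J : Type*} [Fintype J]

theorem pi_gaussianRow_exists_abs_dotProduct_le {c : ℝ} (hc₀ : 0 ≤ c) (hc₁ : c ≤ 1) :
    Measure.pi (fun _ : J => gaussianRow ι)
        {W | ∃ x : ι → ℝ, x ≠ 0 ∧ ∀ j, |W j ⬝ᵥ x| ≤ c * ‖x‖} ≤
      ENNReal.ofReal (2 * Fintype.card ι *
        (4 ^ Fintype.card J * c ^ (Fintype.card J - Fintype.card ι))) := by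
  let sign (σ : Bool) : ℝ := if σ then 1 else -1
  have habs (y : ℝ) : |y| ≤ c ↔ ∀ σ, sign σ * y ≤ c := by simp [sign, abs_le', and_comm]
  have hrow (v : ι → ℝ) (hv : 1 ≤ ‖v‖) :
      gaussianRow ι {w | ∀ σ, (sign σ • w) ⬝ᵥ v ≤ c} ≤ ENNReal.ofReal c := by
    simpa only [smul_dotProduct, smul_eq_mul, ← habs] using gaussianRow_abs_dotProduct_le hv hc₀
  have hsub : {W : J → ι → ℝ | ∃ x, x ≠ 0 ∧ ∀ j, |W j ⬝ᵥ x| ≤ c * ‖x‖} ⊆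
      {W | ∃ x, 1 ≤ ‖x‖ ∧ ∀ j σ, (sign σ • W j) ⬝ᵥ x ≤ c} := by
    rintro W ⟨x, hx₀, hx⟩
    have hpos : 0 < ‖x‖ := norm_pos_iff.2 hx₀
    refine ⟨‖x‖⁻¹ • x, (norm_smul_inv_norm (𝕜 := ℝ) hx₀).ge, fun j => ?_⟩
    simp only [smul_dotProduct, smul_eq_mul]
    rw [← habs, dotProduct_smul, smul_eq_mul, abs_mul, abs_of_pos (inv_pos.2 hpos),
      inv_mul_le_iff₀ hpos, mul_comm]
    exact hx j
  have hc₁' : ENNReal.ofReal c ≤ 1 := by simpa using hc₁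
  calc _ ≤ 2 * Fintype.card ι * ∑ K : Finset (J × Bool) with K.card < Fintype.card ι,
            ENNReal.ofReal c ^ (Fintype.card J - K.card) :=
        (measure_mono hsub).trans (pi_exists_feasible_norm_ge_le _ (fun _ => by fun_prop)
          (fun _ => measurable_const) hc₁' (fun _ _ => hc₀) one_pos hrow)
    _ ≤ 2 * Fintype.card ι * (2 ^ Fintype.card (J × Bool) *
          ENNReal.ofReal c ^ (Fintype.card J - Fintype.card ι)) := by
        gcongr
        exact sum_card_lt_pow_sub_card_le hc₁' _ _
    _ = _ := by
        rw [Fintype.card_prod, Fintype.card_bool, mul_comm (Fintype.card J), pow_mul]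
        norm_num [ENNReal.ofReal_mul, ENNReal.ofReal_pow, hc₀]

/-- The weight `1 / 8` of the binomial sum is chosen so that `8 * (129 / 200) ^ 5 < 1`: the bound is
small as soon as there are five times as many rows as columns. -/
theorem pi_gaussianRow_exists_feasible_le {u : ι → ℝ} (hu : ‖WithLp.toLp 2 u‖ ≤ 1000) :
    Measure.pi (fun _ : J => gaussianRow ι)
        {W | ∃ x : ι → ℝ, feasibleRadius ≤ ‖x‖ ∧ ∀ j, W j ⬝ᵥ x ≤ 2 + max (W j ⬝ᵥ u) 0} ≤
      ENNReal.ofReal (2 * Fintype.card ι *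
        (8 ^ Fintype.card ι * (129 / 200) ^ Fintype.card J)) := by
  have hmeas : Measurable fun w : ι → ℝ => 2 + max (w ⬝ᵥ u) 0 := by
    unfold dotProduct
    fun_prop
  have hinv : ENNReal.ofReal (1 / 8) = 8⁻¹ := by
    rw [one_div, ENNReal.ofReal_inv_of_pos (by norm_num), ENNReal.ofReal_ofNat]
  calc _ ≤ 2 * Fintype.card ι * ∑ K : Finset (J × Unit) with K.card < Fintype.card ι,
            ENNReal.ofReal (13 / 25) ^ (Fintype.card J - K.card) := by
        simpa using pi_exists_feasible_norm_ge_le (J := J) (S := Unit) (gaussianRow ι)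
          (a := fun _ w => w) (b := fun _ w => 2 + max (w ⬝ᵥ u) 0) (fun _ => measurable_id)
          (fun _ => hmeas) (p := ENNReal.ofReal (13 / 25)) (by norm_num) (fun _ _ => by positivity)
          (by norm_num [feasibleRadius] : 0 < feasibleRadius)
          (fun v hv => by simpa using gaussianRow_dotProduct_le_two_add_relu_le hu hv)
    _ ≤ 2 * Fintype.card ι * (8⁻¹⁻¹ ^ Fintype.card ι *
          (8⁻¹ + ENNReal.ofReal (13 / 25)) ^ Fintype.card (J × Unit)) := by
        rw [show Fintype.card J = Fintype.card (J × Unit) by simp]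
        gcongr
        exact sum_card_lt_pow_card_sub_card_le (by simp) (by simp) _
    _ = _ := by
        rw [← hinv, ← ENNReal.ofReal_add (by norm_num) (by norm_num), hinv, inv_inv]
        norm_num [ENNReal.ofReal_mul, ENNReal.ofReal_pow]

end Gaussian

section Chernoff

variable {J E : Type*} [Fintype J] [MeasurableSpace E] (ν : Measure E) [IsProbabilityMeasure ν]
  {A : Set E} [DecidablePred (· ∈ A)]

theorem one_add_pow_mul_pi_card_mem_ge_le (hA : MeasurableSet A) (s : ℝ≥0∞) (m : ℕ) :
    (1 + s) ^ m *
        Measure.pi (fun _ : J => ν) {W | m ≤ (Finset.univ.filter fun j => W j ∈ A).card} ≤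
      (1 + s * ν A) ^ Fintype.card J := by
  let g (w : E) : ℝ≥0∞ := 1 + A.indicator (fun _ => s) w
  have hg : Measurable g := (measurable_const.indicator hA).const_add 1
  have hlintegral : ∫⁻ w, g w ∂ν = 1 + s * ν A := by
    rw [lintegral_add_left measurable_const, lintegral_indicator_const hA, lintegral_one,
      measure_univ]
  have hprod (W : J → E) :
      ∏ j, g (W j) = (1 + s) ^ (Finset.univ.filter fun j => W j ∈ A).card := by
    have hite (j : J) : g (W j) = if W j ∈ A then 1 + s else 1 := by
      by_cases hj : W j ∈ A <;> simp [g, hj]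
    simp only [hite, Finset.prod_ite, Finset.prod_const, one_pow, mul_one]
  have hindep : iIndepFun (fun j (W : J → E) => g (W j)) (Measure.pi fun _ : J => ν) :=
    iIndepFun_pi fun _ => hg.aemeasurable
  calc _ ≤ (1 + s) ^ m * Measure.pi (fun _ : J => ν) {W | (1 + s) ^ m ≤ ∏ j, g (W j)} := by
        gcongr with W
        intro hW
        rw [hprod]
        exact pow_le_pow_right₀ le_self_add hW
    _ ≤ ∫⁻ W, ∏ j, g (W j) ∂(Measure.pi fun _ : J => ν) :=
        mul_meas_ge_le_lintegral (Finset.measurable_prod _ fun j _ =>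
          hg.comp (measurable_pi_apply j)) _
    _ = ∏ j, ∫⁻ W, g (W j) ∂(Measure.pi fun _ : J => ν) :=
        lintegral_prod_eq_prod_lintegral_of_indepFun _ _ hindep fun j =>
          hg.comp (measurable_pi_apply j)
    _ = (1 + s * ν A) ^ Fintype.card J := by
        simp only [(measurePreserving_eval (fun _ : J => ν) _).lintegral_comp hg, hlintegral,
          Finset.prod_const, Finset.card_univ]

theorem pow_le_pow_mul_pow_of_three_mul_le {N m : ℕ} (hm : 3 * N ≤ 5 * m) :
    (1251 / 1000 : ℝ) ^ N ≤ (3 / 2) ^ m * (99 / 100) ^ N := by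
  refine le_of_pow_le_pow_left₀ (n := 5) (by norm_num) (by positivity) ?_
  calc ((1251 / 1000 : ℝ) ^ N) ^ 5 = ((1251 / 1000) ^ 5) ^ N := pow_right_comm _ _ _
    _ ≤ ((3 / 2) ^ 3 * (99 / 100) ^ 5) ^ N := by gcongr; norm_num
    _ = (3 / 2) ^ (3 * N) * ((99 / 100) ^ N) ^ 5 := by
        rw [mul_pow, pow_mul, pow_right_comm (99 / 100 : ℝ)]
    _ ≤ (3 / 2) ^ (5 * m) * ((99 / 100) ^ N) ^ 5 := by gcongr; norm_num
    _ = ((3 / 2) ^ m * (99 / 100) ^ N) ^ 5 := by rw [mul_pow, ← pow_mul _ m, mul_comm m]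

theorem pi_three_mul_card_le_five_mul_card_mem_le (hA : MeasurableSet A)
    (hνA : ν A ≤ ENNReal.ofReal (251 / 500)) {m : ℕ} (hm : 3 * Fintype.card J ≤ 5 * m) :
    Measure.pi (fun _ : J => ν) {W | m ≤ (Finset.univ.filter fun j => W j ∈ A).card} ≤
      ENNReal.ofReal ((99 / 100) ^ Fintype.card J) := by
  have hbase : 1 + ENNReal.ofReal (1 / 2) * ν A ≤ ENNReal.ofReal (1251 / 1000) := by
    calc _ ≤ 1 + ENNReal.ofReal (1 / 2) * ENNReal.ofReal (251 / 500) := by gcongr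
      _ = ENNReal.ofReal (1251 / 1000) := by
          rw [← ENNReal.ofReal_mul (by norm_num), ← ENNReal.ofReal_one,
            ← ENNReal.ofReal_add (by norm_num) (by norm_num)]
          norm_num
  have hpow : (1 + ENNReal.ofReal (1 / 2)) ^ m = ENNReal.ofReal ((3 / 2) ^ m) := by
    rw [ENNReal.ofReal_pow (by norm_num), ← ENNReal.ofReal_one,
      ← ENNReal.ofReal_add (by norm_num) (by norm_num)]
    norm_num
  have hchernoff := one_add_pow_mul_pi_card_mem_ge_le (J := J) ν hA (ENNReal.ofReal (1 / 2)) m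
  rw [hpow] at hchernoff
  refine (ENNReal.mul_le_mul_iff_right (a := ENNReal.ofReal ((3 / 2) ^ m)) (by positivity)
    ENNReal.ofReal_ne_top).1 (hchernoff.trans ((pow_le_pow_left' hbase _).trans ?_))
  rw [← ENNReal.ofReal_pow (by norm_num), ← ENNReal.ofReal_mul (by positivity)]
  exact ENNReal.ofReal_le_ofReal (pow_le_pow_mul_pow_of_three_mul_le hm)

end Chernoff

/-- The rows of `A` that a layer with weights `A` maps, on the input `y`, to outputs that are large
compared with `y`. -/
noncomputable def activeRows {J ι : Type*} [Fintype J] [Fintype ι] (A : Matrix J ι ℝ)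
    (y : ι → ℝ) : Finset J :=
  Finset.univ.filter fun j => 1 / 500 * ‖WithLp.toLp 2 y‖ < (A.mulVec y) j

theorem pi_gaussianRow_card_activeRows_lt_le {J ι : Type*} [Fintype J] [Fintype ι] {m : ℕ}
    (hm : 5 * m ≤ 2 * Fintype.card J) {y : ι → ℝ} (hy : y ≠ 0) :
    Measure.pi (fun _ : J => gaussianRow ι) {W | (activeRows (Matrix.of W) y).card < m} ≤
      ENNReal.ofReal ((99 / 100) ^ Fintype.card J) := by
  classical
  let A : Set (ι → ℝ) := {w | w ⬝ᵥ y ≤ 1 / 500 * ‖WithLp.toLp 2 y‖}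
  have hA : MeasurableSet A := measurableSet_le (by unfold dotProduct; fun_prop) measurable_const
  have hpos : 0 < ‖WithLp.toLp 2 y‖ := norm_pos_iff.2 (by simpa using hy)
  have hνA : gaussianRow ι A ≤ ENNReal.ofReal (251 / 500) := by
    refine (gaussianRow_dotProduct_le hy (by positivity)).trans
      (ENNReal.ofReal_le_ofReal ?_)
    have hratio : 1 / 500 * ‖WithLp.toLp 2 y‖ / (2 * ‖WithLp.toLp 2 y‖) = 1 / 1000 := by
      field_simp
      norm_num
    rw [hratio]
    norm_num
  refine (measure_mono fun W (hW : (activeRows (Matrix.of W) y).card < m) => ?_).trans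
    (pi_three_mul_card_le_five_mul_card_mem_le (J := J) (gaussianRow ι) hA hνA
      (m := Fintype.card J - m) (by omega))
  have hcompl : (Finset.univ.filter fun j => W j ∈ A) = (activeRows (Matrix.of W) y)ᶜ := by
    ext j
    simp [A, activeRows, Matrix.mulVec]
  rw [Set.mem_ofPred_eq, hcompl, Finset.card_compl]
  exact Nat.sub_le_sub_left hW.le _

section LinearProgram

variable {N k : ℕ} {A : Matrix (Fin N) (Fin k) ℝ} {x : Fin N → ℝ} {ε r : ℝ} {a : Fin k → ℝ}

/-- The linear program with data `A`, `x`, `ε` has a solution, and each of its solutions is an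
approximation of `a` with error at most `r` in the sup norm. -/
def LPRecovers (A : Matrix (Fin N) (Fin k) ℝ) (x : Fin N → ℝ) (ε : ℝ) (a : Fin k → ℝ) (r : ℝ) :
    Prop :=
  (∃ z, IsLPSolution A x ε z) ∧ ∀ z, IsLPSolution A x ε z → ‖z - a‖ ≤ r

theorem LPRecovers.mono {r' : ℝ} (h : LPRecovers A x ε a r) (hr : r ≤ r') :
    LPRecovers A x ε a r' :=
  ⟨h.1, fun z hz => (h.2 z hz).trans hr⟩

theorem LPFeasible.mulVec_le {z : Fin k → ℝ} {δ : ℝ} (h : LPFeasible A x ε z δ) (j : Fin N) :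
    (A.mulVec z) j ≤ x j + δ :=
  (lt_or_ge ε (x j)).elim (fun hj => (h.1 j hj).2) (h.2.1 j)

theorem continuous_mulVec_apply (A : Matrix (Fin N) (Fin k) ℝ) (j : Fin N) :
    Continuous fun z => (A.mulVec z) j :=
  (continuous_apply j).comp (continuous_const.matrix_mulVec continuous_id)

theorem isClosed_lpFeasible (A : Matrix (Fin N) (Fin k) ℝ) (x : Fin N → ℝ) (ε : ℝ) :
    IsClosed {q : (Fin k → ℝ) × ℝ | LPFeasible A x ε q.1 q.2} := by
  have hA (j : Fin N) : Continuous fun q : (Fin k → ℝ) × ℝ => (A.mulVec q.1) j :=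
    (continuous_mulVec_apply A j).comp continuous_fst
  simp only [LPFeasible, Set.ofPred_and, Set.ofPred_forall]
  refine (isClosed_iInter fun j => isClosed_iInter fun _ => ?_).inter
    ((isClosed_iInter fun j => isClosed_iInter fun _ => ?_).inter ?_)
  · exact (isClosed_le (by fun_prop) (hA j)).inter (isClosed_le (hA j) (by fun_prop))
  · exact isClosed_le (hA j) (by fun_prop)
  · exact isClosed_le (by fun_prop) (by fun_prop)

theorem exists_isLPSolution_of_norm_le {B : ℝ} (hN : 0 < N) (hne : ∃ z δ, LPFeasible A x ε z δ)
    (hB : ∀ z δ, LPFeasible A x ε z δ → ‖z‖ ≤ B) : ∃ z, IsLPSolution A x ε z := by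
  let F : Set ((Fin k → ℝ) × ℝ) := {q | LPFeasible A x ε q.1 q.2}
  obtain ⟨L, hL⟩ := (isCompact_closedBall (0 : Fin k → ℝ) B).bddBelow_image
    (continuous_mulVec_apply A ⟨0, hN⟩).continuousOn
  have hsubset : F ⊆ Metric.closedBall 0 B ×ˢ Set.Icc (L - x ⟨0, hN⟩) ε := fun q hq => by
    have hball : q.1 ∈ Metric.closedBall 0 B := by simpa using hB _ _ hq
    have hlower := hL (Set.mem_image_of_mem _ hball)
    exact ⟨hball, by linarith [hq.mulVec_le ⟨0, hN⟩], hq.2.2⟩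
  have hcompact : IsCompact F := ((isCompact_closedBall _ _).prod isCompact_Icc).of_isClosed_subset
    (isClosed_lpFeasible A x ε) hsubset
  obtain ⟨z₀, δ₀, h₀⟩ := hne
  obtain ⟨⟨z, δ⟩, hz, hmin⟩ :=
    hcompact.exists_isMinOn ⟨(z₀, δ₀), h₀⟩ continuous_snd.continuousOn
  exact ⟨z, δ, hz, fun z' δ' h' => hmin (show (z', δ') ∈ F from h')⟩

theorem abs_sub_max_le_of_norm_sub_reluLayer_le (hx : ‖x - reluLayer A a‖ ≤ ε) (j : Fin N) :
    |x j - max ((A.mulVec a) j) 0| ≤ ε :=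
  (norm_le_pi_norm (x - reluLayer A a) j).trans hx

theorem lpFeasible_of_norm_sub_reluLayer_le (hx : ‖x - reluLayer A a‖ ≤ ε) :
    LPFeasible A x ε a ε := by
  have hj (j : Fin N) := abs_le.1 (abs_sub_max_le_of_norm_sub_reluLayer_le hx j)
  refine ⟨fun j hactive => ?_, fun j _ => ?_, le_rfl⟩
  · have hpos : 0 < (A.mulVec a) j := by
      by_contra! hle
      linarith [(hj j).2, max_eq_right hle]
    constructor <;> linarith [(hj j).1, (hj j).2, max_eq_left hpos.le]
  · linarith [(hj j).1, le_max_left ((A.mulVec a) j) 0]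

theorem lpRecovers_of_forall_lpFeasible (hN : 0 < N) (hx : ‖x - reluLayer A a‖ ≤ ε)
    (h : ∀ z δ, LPFeasible A x ε z δ → ‖z - a‖ ≤ r) : LPRecovers A x ε a r := by
  refine ⟨exists_isLPSolution_of_norm_le (B := r + ‖a‖) hN
    ⟨a, ε, lpFeasible_of_norm_sub_reluLayer_le hx⟩ fun z δ hz => ?_,
    fun z ⟨δ, hz, _⟩ => h z δ hz⟩
  linarith [h z δ hz, norm_le_norm_sub_add z a]

theorem lpRecovers_of_rowsExtend {c : ℝ} (hc : 0 < c) (hx : ‖x - reluLayer A a‖ ≤ ε)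
    {I : Finset (Fin N)} (hI : I.Nonempty) (hlarge : ∀ j ∈ I, 2 * ε < (A.mulVec a) j)
    (hext : RowsExtend A I c) : LPRecovers A x ε a (ε * (2 / c)) := by
  have hε : 0 ≤ ε := (norm_nonneg _).trans hx
  refine lpRecovers_of_forall_lpFeasible hI.choose.pos hx fun z δ hz => ?_
  have hrow (j : Fin N) (hj : j ∈ I) : |(A.mulVec z) j - (A.mulVec a) j| ≤ 2 * ε := by
    have hxj := abs_le.1 (abs_sub_max_le_of_norm_sub_reluLayer_le hx j)
    rw [max_eq_left (by linarith [hlarge j hj])] at hxj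
    have hzj := hz.1 j (by linarith [hlarge j hj])
    exact abs_le.2 ⟨by linarith [hz.2.2], by linarith [hz.2.2]⟩
  have hnorm : ‖(A.submatrix (fun j : I => (j : Fin N)) id).mulVec (z - a)‖ ≤ 2 * ε := by
    refine (pi_norm_le_iff_of_nonneg (by positivity)).2 fun j => ?_
    rw [Matrix.mulVec_sub]
    exact hrow j j.2
  rw [mul_div_assoc', le_div_iff₀ hc]
  linarith [(hext (z - a)).trans hnorm]

theorem reluLayer_smul (A : Matrix (Fin N) (Fin k) ℝ) {s : ℝ} (hs : 0 ≤ s) (b : Fin k → ℝ) :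
    reluLayer A (s • b) = s • reluLayer A b := by
  ext j
  simp only [reluLayer, Matrix.mulVec_smul, Pi.smul_apply, smul_eq_mul, mul_max_of_nonneg _ _ hs,
    mul_zero]

/-- The vectors that satisfy, with error bound `1`, all the upper constraints of the linear program
for some observation within distance `1` of the output of the layer on `b`. -/
def relaxedPolyhedron (A : Matrix (Fin N) (Fin k) ℝ) (b : Fin k → ℝ) : Set (Fin k → ℝ) :=
  {v | ∀ j, (A.mulVec v) j ≤ 2 + reluLayer A b j}

theorem LPFeasible.inv_smul_mem_relaxedPolyhedron {s δ : ℝ} {b z : Fin k → ℝ} (hε : 0 < ε)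
    (hs₀ : 0 ≤ s) (hs : s ≤ ε) (hx : ‖x - reluLayer A (s • b)‖ ≤ ε) (hz : LPFeasible A x ε z δ) :
    ε⁻¹ • z ∈ relaxedPolyhedron A b := fun j => by
  have hxj := abs_le.1 ((norm_le_pi_norm (x - reluLayer A (s • b)) j).trans hx)
  rw [reluLayer_smul A hs₀, Pi.sub_apply, Pi.smul_apply, smul_eq_mul] at hxj
  have hscale : s * reluLayer A b j ≤ ε * reluLayer A b j :=
    mul_le_mul_of_nonneg_right hs (le_max_right _ _)
  rw [Matrix.mulVec_smul, Pi.smul_apply, smul_eq_mul, inv_mul_le_iff₀ hε]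
  linarith [hz.mulVec_le j, hz.2.2]

theorem lpRecovers_of_relaxedPolyhedron_subset {R s : ℝ} {b : Fin k → ℝ} (hN : 0 < N) (hε : 0 < ε)
    (hs₀ : 0 ≤ s) (hs : s ≤ ε) (hR : relaxedPolyhedron A b ⊆ Metric.closedBall 0 R)
    (hx : ‖x - reluLayer A (s • b)‖ ≤ ε) : LPRecovers A x ε (s • b) (ε * (R + ‖b‖)) := by
  refine lpRecovers_of_forall_lpFeasible hN hx fun z δ hz => ?_
  have hz' := mem_closedBall_zero_iff.1 (hR (hz.inv_smul_mem_relaxedPolyhedron hε hs₀ hs hx))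
  rw [norm_smul, norm_inv, Real.norm_of_nonneg hε.le, inv_mul_le_iff₀ hε] at hz'
  calc ‖z - s • b‖ ≤ ‖z‖ + ‖s • b‖ := norm_sub_le _ _
    _ = ‖z‖ + s * ‖b‖ := by rw [norm_smul, Real.norm_of_nonneg hs₀]
    _ ≤ ε * R + ε * ‖b‖ := by gcongr
    _ = ε * (R + ‖b‖) := (mul_add _ _ _).symm

end LinearProgram

section GoodLayer

variable {N k m : ℕ} {A : Matrix (Fin N) (Fin k) ℝ} {x : Fin N → ℝ} {y : Fin k → ℝ} {ε c : ℝ}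

/-- The weights `A` extend the sup norm on all submatrices with at least `m` rows, and at least `m`
outputs of the layer are large on the input `y`, unless `y = 0`. -/
structure IsGoodLayer (A : Matrix (Fin N) (Fin k) ℝ) (y : Fin k → ℝ) (m : ℕ) (c : ℝ) : Prop where
  rowsExtend : ∀ I : Finset (Fin N), m ≤ I.card → RowsExtend A I c
  le_card_activeRows : y ≠ 0 → m ≤ (activeRows A y).card

theorem sqrt_card_activeRows_mul_le_norm_reluLayer (A : Matrix (Fin N) (Fin k) ℝ)
    (y : Fin k → ℝ) :
    √(activeRows A y).card * (1 / 500 * ‖WithLp.toLp 2 y‖) ≤ ‖WithLp.toLp 2 (reluLayer A y)‖ := by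
  rw [EuclideanSpace.norm_eq (WithLp.toLp 2 (reluLayer A y))]
  apply Real.le_sqrt_of_sq_le
  rw [mul_pow, Real.sq_sqrt (by positivity)]
  calc _ = ∑ j ∈ activeRows A y, (1 / 500 * ‖WithLp.toLp 2 y‖) ^ 2 := by
        rw [Finset.sum_const, nsmul_eq_mul]
    _ ≤ ∑ j ∈ activeRows A y, ‖reluLayer A y j‖ ^ 2 := by
        gcongr with j hj
        exact (Finset.mem_filter.1 hj).2.le.trans ((le_max_left _ _).trans (le_abs_self _))
    _ ≤ ∑ j, ‖reluLayer A y j‖ ^ 2 :=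
        Finset.sum_le_univ_sum_of_nonneg fun _ => by positivity

theorem IsGoodLayer.sqrt_mul_le_norm_reluLayer (h : IsGoodLayer A y m c) :
    √m * (1 / 500 * ‖WithLp.toLp 2 y‖) ≤ ‖WithLp.toLp 2 (reluLayer A y)‖ := by
  rcases eq_or_ne y 0 with rfl | hy
  · simp
  · exact (by gcongr; exact h.le_card_activeRows hy : _ ≤ _).trans
      (sqrt_card_activeRows_mul_le_norm_reluLayer A y)

theorem IsGoodLayer.lpRecovers (h : IsGoodLayer A y m c) (hc : 0 < c) (hm : 0 < m) (hy : y ≠ 0)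
    (hε : 2 * ε ≤ 1 / 500 * ‖WithLp.toLp 2 y‖) (hx : ‖x - reluLayer A y‖ ≤ ε) :
    LPRecovers A x ε y (ε * (2 / c)) :=
  lpRecovers_of_rowsExtend hc hx (Finset.card_pos.1 (hm.trans_le (h.le_card_activeRows hy)))
    (fun _ hj => hε.trans_lt (Finset.mem_filter.1 hj).2)
    (h.rowsExtend _ (h.le_card_activeRows hy))

theorem lpRecovers_of_norm_le_mul {R : ℝ} (hN : 0 < N) (hc : 0 < c) (hcR : c * (R + 1000) ≤ 2)
    (hy : y ≠ 0) (hε : ‖WithLp.toLp 2 y‖ ≤ 1000 * ε)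
    (hR : relaxedPolyhedron A ((1000 / ‖WithLp.toLp 2 y‖) • y) ⊆ Metric.closedBall 0 R)
    (hx : ‖x - reluLayer A y‖ ≤ ε) : LPRecovers A x ε y (ε * (2 / c)) := by
  have hypos : 0 < ‖WithLp.toLp 2 y‖ := norm_pos_iff.2 (by simpa using hy)
  have hεpos : 0 < ε := by linarith
  have hrescale : y = (‖WithLp.toLp 2 y‖ / 1000) • (1000 / ‖WithLp.toLp 2 y‖) • y := by
    rw [smul_smul, div_mul_div_cancel₀ (by norm_num), div_self hypos.ne', one_smul]
  have hnorm : ‖(1000 / ‖WithLp.toLp 2 y‖) • y‖ ≤ 1000 := by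
    rw [norm_smul, Real.norm_of_nonneg (by positivity), div_mul_eq_mul_div, div_le_iff₀ hypos]
    gcongr
    exact norm_le_norm_toLp_two y
  have hrecovers := lpRecovers_of_relaxedPolyhedron_subset (x := x) hN hεpos
    (s := ‖WithLp.toLp 2 y‖ / 1000) (by positivity) (by linarith) hR (hrescale ▸ hx)
  rw [← hrescale] at hrecovers
  refine hrecovers.mono (mul_le_mul_of_nonneg_left ?_ hεpos.le)
  rw [le_div_iff₀ hc]
  nlinarith

end GoodLayer

section Network

variable {n m : ℕ → ℕ} {W : (i : ℕ) → Matrix (Fin (n (i + 1))) (Fin (n i)) ℝ} {d : ℕ}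
  {z : Fin (n 0) → ℝ} {c : ℝ}

theorem inversionRecovers_of_forall_lpRecovers {y : (i : ℕ) → Fin (n i) → ℝ} {x : Fin (n d) → ℝ}
    {tol : ℕ → ℝ} (hx : ‖x - y d‖ ≤ tol d)
    (hstep : ∀ i < d, ∀ x', ‖x' - y (i + 1)‖ ≤ tol (i + 1) →
      LPRecovers (W i) x' (tol (i + 1)) (y i) (tol i)) :
    InversionRecovers n W d x tol (y 0) (tol 0) := by
  have hreach (i : ℕ) (x') (h : InversionReaches n W d x tol i x') :
      i ≤ d ∧ ‖x' - y i‖ ≤ tol i := by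
    induction h with
    | start => exact ⟨le_rfl, hx⟩
    | step _ hsol ih => exact ⟨by omega, (hstep _ ih.1 _ ih.2).2 _ hsol⟩
  exact ⟨fun i hi x' hx' => (hstep i hi x' (hreach _ _ hx').2).1, fun z hz => (hreach 0 z hz).2⟩

theorem pow_mul_le_norm_netOutput (hn : ∀ i < d, 0 < n i) (hm : ∀ i < d, n i ≤ m i)
    (hgood : ∀ i < d, IsGoodLayer (W i) (netOutput n W z i) (m i) c) {i : ℕ} (hi : i < d) :
    (1 / 500) ^ (i + 1) * (√(n 0) * ‖WithLp.toLp 2 z‖) ≤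
      ‖WithLp.toLp 2 (netOutput n W z (i + 1))‖ := by
  refine le_trans ?_ (hgood i hi).sqrt_mul_le_norm_reluLayer
  induction i with
  | zero =>
    calc _ = √(n 0) * (1 / 500 * ‖WithLp.toLp 2 z‖) := by ring
      _ ≤ √(m 0) * (1 / 500 * ‖WithLp.toLp 2 z‖) := by gcongr; exact hm 0 hi
  | succ i ih =>
    have hone : 1 ≤ √(m (i + 1)) := by
      rw [Real.one_le_sqrt]
      exact_mod_cast (hn _ hi).trans_le (hm _ hi)
    have hprev := (ih (by omega)).trans (hgood i (by omega)).sqrt_mul_le_norm_reluLayer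
    calc _ = 1 / 500 * ((1 / 500) ^ (i + 1) * (√(n 0) * ‖WithLp.toLp 2 z‖)) := by ring
      _ ≤ 1 / 500 * ‖WithLp.toLp 2 (netOutput n W z (i + 1))‖ := by gcongr; exact hprev
      _ ≤ _ := le_mul_of_one_le_left (by positivity) hone

theorem netOutput_ne_zero (hn : ∀ i < d, 0 < n i) (hm : ∀ i < d, n i ≤ m i) (hz : z ≠ 0)
    (hgood : ∀ i < d, IsGoodLayer (W i) (netOutput n W z i) (m i) c) {i : ℕ} (hi : i < d) :
    netOutput n W z i ≠ 0 := by
  cases i with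
  | zero => exact hz
  | succ i =>
    have hn₀ : (0 : ℝ) < n 0 := by exact_mod_cast hn 0 (by omega)
    have hzpos : 0 < ‖WithLp.toLp 2 z‖ := norm_pos_iff.2 (by simpa using hz)
    have hpos : 0 < ‖WithLp.toLp 2 (netOutput n W z (i + 1))‖ :=
      lt_of_lt_of_le (by positivity) (pow_mul_le_norm_netOutput hn hm hgood (i := i) (by omega))
    simpa using norm_pos_iff.1 hpos

theorem mul_pow_sub_le_of_le_mul {c t b : ℝ} (hc : 0 < c) (hc' : c ≤ 1 / 250) (hb : 0 ≤ b)
    (ht : t ≤ c ^ d / 2 ^ (d + 4) * b) {i : ℕ} (hi : i ≤ d) :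
    t * (2 / c) ^ (d - i) ≤ 1 / 16 * (1 / 500) ^ i * b := by
  have hcancel : c ^ d / 2 ^ (d + 4) * (2 / c) ^ (d - i) = 1 / 16 * (c / 2) ^ i := by
    obtain ⟨q, rfl⟩ := Nat.exists_eq_add_of_le hi
    rw [Nat.add_sub_cancel_left, div_pow, div_pow]
    field_simp
    ring
  calc t * (2 / c) ^ (d - i) ≤ c ^ d / 2 ^ (d + 4) * b * (2 / c) ^ (d - i) := by gcongr
    _ = 1 / 16 * (c / 2) ^ i * b := by rw [mul_right_comm, hcancel]
    _ ≤ 1 / 16 * (1 / 500) ^ i * b := by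
        gcongr 1 / 16 * ?_ ^ i * b
        linarith

theorem two_mul_tolerance_le_norm_netOutput (hc : 0 < c) (hc' : c ≤ 1 / 250) (hn : ∀ i < d, 0 < n i)
    (hm : ∀ i < d, n i ≤ m i) (hgood : ∀ i < d, IsGoodLayer (W i) (netOutput n W z i) (m i) c)
    {t : ℝ} (ht : t ≤ c ^ d / 2 ^ (d + 4) * ‖WithLp.toLp 2 z‖ * √(n 0)) {i : ℕ} (hi : i + 1 < d) :
    2 * (t * (2 / c) ^ (d - (i + 2))) ≤
      1 / 500 * ‖WithLp.toLp 2 (netOutput n W z (i + 1))‖ := by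
  have hsmall := mul_pow_sub_le_of_le_mul hc hc' (by positivity)
    (ht.trans_eq (by ring : _ = c ^ d / 2 ^ (d + 4) * (√(n 0) * ‖WithLp.toLp 2 z‖))) hi
  have hlarge := pow_mul_le_norm_netOutput hn hm hgood (i := i) (by omega)
  have hnonneg : 0 ≤ (1 / 500 : ℝ) ^ (i + 1) * (√(n 0) * ‖WithLp.toLp 2 z‖) := by positivity
  rw [pow_succ] at hsmall
  linarith

theorem inversionRecovers_of_isGoodLayer {R : ℝ} (hc : 0 < c) (hc' : c ≤ 1 / 250)
    (hcR : c * (R + 1000) ≤ 2) (hn : ∀ i ≤ d, 0 < n i) (hm : ∀ i < d, n i ≤ m i) (hz : z ≠ 0)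
    (hgood : ∀ i < d, IsGoodLayer (W i) (netOutput n W z i) (m i) c)
    (hR : 0 < d → relaxedPolyhedron (W 0) ((1000 / ‖WithLp.toLp 2 z‖) • z) ⊆
      Metric.closedBall 0 R)
    {e : Fin (n d) → ℝ} (he : ‖e‖ < c ^ d / 2 ^ (d + 4) * ‖WithLp.toLp 2 z‖ * √(n 0)) :
    InversionRecovers n W d (netOutput n W z d + e) (fun i => ‖e‖ * (2 / c) ^ (d - i)) z
      (2 ^ d * ‖e‖ / c ^ d) := by
  have hn' : ∀ i < d, 0 < n i := fun i hi => hn i hi.le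
  set tol : ℕ → ℝ := fun i => ‖e‖ * (2 / c) ^ (d - i) with htol
  have htol_zero : 2 ^ d * ‖e‖ / c ^ d = tol 0 := by
    simp only [htol, Nat.sub_zero, div_pow]
    ring
  have htol_succ (i : ℕ) (hi : i < d) : tol i = tol (i + 1) * (2 / c) := by
    simp only [htol]
    rw [mul_assoc, ← pow_succ, show d - (i + 1) + 1 = d - i by omega]
  rw [htol_zero]
  refine inversionRecovers_of_forall_lpRecovers (y := netOutput n W z) (by simp [htol]) ?_
  intro i hi x hx
  rw [htol_succ i hi]
  have hne := netOutput_ne_zero hn' hm hz hgood hi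
  rcases le_or_gt (2 * tol (i + 1)) (1 / 500 * ‖WithLp.toLp 2 (netOutput n W z i)‖) with hle | hgt
  · exact (hgood i hi).lpRecovers hc ((hn' i hi).trans_le (hm i hi)) hne hle hx
  · obtain rfl : i = 0 := by
      by_contra hi₀
      obtain ⟨l, rfl⟩ := Nat.exists_eq_succ_of_ne_zero hi₀
      exact (two_mul_tolerance_le_norm_netOutput hc hc' hn' hm hgood he.le hi).not_gt hgt
    have hgt' : 1 / 500 * ‖WithLp.toLp 2 z‖ < 2 * tol 1 := hgt
    exact lpRecovers_of_norm_le_mul (y := z) (hn 1 hi) hc hcR hz (by linarith) (hR hi) hx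

end Network

section Law

theorem measurePreserving_curry_pi {J ι E : Type*} [Fintype J] [Fintype ι] [MeasurableSpace E]
    (ν : Measure E) [IsProbabilityMeasure ν] :
    MeasurePreserving (Function.curry : (J × ι → E) → J → ι → E) (Measure.pi fun _ => ν)
      (Measure.pi fun _ => Measure.pi fun _ => ν) := by
  have hcurry := Measure.infinitePi_map_curry fun (_ : J) (_ : ι) => ν
  simp only [Measure.infinitePi_eq_pi] at hcurry
  exact ⟨measurable_pi_lambda _ fun _ => measurable_pi_lambda _ fun _ => measurable_pi_apply _,
    hcurry⟩

theorem measurableSet_card_activeRows_lt {J ι : Type*} [Fintype J] [Fintype ι] (m : ℕ) :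
    MeasurableSet {q : (ι → ℝ) × (J → ι → ℝ) | (activeRows (Matrix.of q.2) q.1).card < m} := by
  have hcard : Measurable fun q : (ι → ℝ) × (J → ι → ℝ) =>
      ∑ j, if 1 / 500 * ‖WithLp.toLp 2 q.1‖ < q.2 j ⬝ᵥ q.1 then 1 else 0 := by
    have : Measurable fun v : ι → ℝ => WithLp.toLp 2 v := by fun_prop
    refine Finset.measurable_fun_sum _ fun j _ =>
      Measurable.ite (measurableSet_lt (by fun_prop) ?_) measurable_const measurable_const
    unfold dotProduct
    fun_prop
  simp only [activeRows, Finset.card_filter]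
  exact measurableSet_lt hcard measurable_const

theorem netOutput_congr {n : ℕ → ℕ} {W W' : (i : ℕ) → Matrix (Fin (n (i + 1))) (Fin (n i)) ℝ}
    (z : Fin (n 0) → ℝ) {i : ℕ} (h : ∀ j < i, W j = W' j) :
    netOutput n W z i = netOutput n W' z i := by
  induction i with
  | zero => rfl
  | succ i ih => rw [netOutput, netOutput, ih fun j hj => h j (by omega), h i (by omega)]

theorem measurable_netOutput {α : Type*} [MeasurableSpace α] {n : ℕ → ℕ}
    {W : α → (i : ℕ) → Matrix (Fin (n (i + 1))) (Fin (n i)) ℝ} (z : Fin (n 0) → ℝ)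
    (hW : ∀ i a b, Measurable fun x => W x i a b) (i : ℕ) :
    Measurable fun x => netOutput n (W x) z i := by
  induction i with
  | zero => exact measurable_const
  | succ i ih =>
    refine measurable_pi_lambda _ fun a => Measurable.max ?_ measurable_const
    unfold Matrix.mulVec dotProduct
    exact Finset.measurable_fun_sum _ fun b _ => (hW i a b).mul ((measurable_pi_apply b).comp ih)

theorem exists_measurable_netOutput_eq (d : ℕ) {n : ℕ → ℕ} (z : Fin (n 0) → ℝ) {i : ℕ}
    (hi : i ≤ d) :
    ∃ g : ({p : Σ l : Fin d, Fin (n (l + 1)) × Fin (n l) // p.1 < i} → ℝ) → Fin (n i) → ℝ,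
      Measurable g ∧ ∀ W : (l : ℕ) → Matrix (Fin (n (l + 1))) (Fin (n l)) ℝ,
        netOutput n W z i = g fun p => W p.1.1 p.1.2.1 p.1.2.2 := by
  let V (x : {p : Σ l : Fin d, Fin (n (l + 1)) × Fin (n l) // p.1 < i} → ℝ) (l : ℕ) :
      Matrix (Fin (n (l + 1))) (Fin (n l)) ℝ := fun a b =>
    if h : l < i then x ⟨⟨⟨l, h.trans_le hi⟩, a, b⟩, h⟩ else 0
  have hV (l : ℕ) (a : Fin (n (l + 1))) (b : Fin (n l)) : Measurable fun x => V x l a b := by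
    by_cases h : l < i
    · simp only [V, h, dite_true]
      fun_prop
    · simp only [V, h, dite_false]
      exact measurable_const
  refine ⟨fun x => netOutput n (V x) z i, measurable_netOutput z hV i, fun W => ?_⟩
  refine netOutput_congr z fun l hl => ?_
  ext a b
  simp [V, hl]

variable {Ω : Type*} [MeasurableSpace Ω] {μ : Measure Ω} {d : ℕ}
  {n : ℕ → ℕ} {W : (i : ℕ) → Ω → Matrix (Fin (n (i + 1))) (Fin (n i)) ℝ} {i : ℕ}

theorem IsIIDStdGaussian.hasLaw_rows (hW : IsIIDStdGaussian μ d n W) (hi : i < d)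
    {J : Type*} [Fintype J] {f : J → Fin (n (i + 1))} (hf : Function.Injective f) :
    HasLaw (fun ω (j : J) => W i ω (f j)) (Measure.pi fun _ => gaussianRow (Fin (n i))) μ := by
  let g (q : J × Fin (n i)) : Σ i : Fin d, Fin (n (i + 1)) × Fin (n i) := ⟨⟨i, hi⟩, f q.1, q.2⟩
  have hg : Function.Injective g := by
    rintro ⟨a, b⟩ ⟨a', b'⟩ h
    simp only [g, Sigma.mk.injEq, heq_eq_eq, Prod.mk.injEq, true_and] at h
    exact Prod.ext (hf h.1) h.2
  exact (measurePreserving_curry_pi (gaussianReal 0 1)).fun_comp_hasLaw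
    ((hW.2.precomp hg).hasLaw_pi fun q => hW.1 i hi (f q.1) q.2)

theorem IsIIDStdGaussian.measure_rows_mem_le (hW : IsIIDStdGaussian μ d n W) (hi : i < d)
    {J : Type*} [Fintype J] {f : J → Fin (n (i + 1))} (hf : Function.Injective f)
    (B : Set (J → Fin (n i) → ℝ)) :
    μ {ω | (fun j : J => W i ω (f j)) ∈ B} ≤ Measure.pi (fun _ => gaussianRow (Fin (n i))) B := by
  have hlaw := hW.hasLaw_rows hi hf
  rw [← hlaw.map_eq]
  exact Measure.le_map_apply hlaw.aemeasurable B

theorem IsIIDStdGaussian.measure_not_rowsExtend_le (hW : IsIIDStdGaussian μ d n W) (hi : i < d)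
    (I : Finset (Fin (n (i + 1)))) {c : ℝ} (hc₀ : 0 ≤ c) (hc₁ : c ≤ 1) :
    μ {ω | ¬ RowsExtend (W i ω) I c} ≤
      ENNReal.ofReal (2 * n i * (4 ^ I.card * c ^ (I.card - n i))) := by
  have hsmall := pi_gaussianRow_exists_abs_dotProduct_le (J := I) (ι := Fin (n i)) hc₀ hc₁
  rw [Fintype.card_coe, Fintype.card_fin] at hsmall
  refine (measure_mono fun ω hω => ?_).trans
    ((hW.measure_rows_mem_le hi (Subtype.val_injective (p := (· ∈ I))) _).trans hsmall)
  obtain ⟨x, hx⟩ := not_forall.1 hω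
  rw [not_le] at hx
  refine ⟨x, ?_, fun j => ?_⟩
  · rintro rfl
    simp at hx
  · exact (norm_le_pi_norm (((W i ω).submatrix (fun j : I => (j : Fin (n (i + 1)))) id).mulVec x)
      j).trans hx.le

variable [IsProbabilityMeasure μ]

theorem IsIIDStdGaussian.hasLaw_netOutput_prodMk (hW : IsIIDStdGaussian μ d n W) (hi : i < d)
    (z : Fin (n 0) → ℝ) :
    HasLaw (fun ω => (netOutput n (fun i => W i ω) z i, fun j => W i ω j))
      ((μ.map fun ω => netOutput n (fun i => W i ω) z i).prod
        (Measure.pi fun _ => gaussianRow (Fin (n i)))) μ := by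
  have hentry (p : Σ l : Fin d, Fin (n (l + 1)) × Fin (n l)) :
      AEMeasurable (fun ω => W p.1 ω p.2.1 p.2.2) μ := (hW.1 p.1 p.1.2 p.2.1 p.2.2).aemeasurable
  obtain ⟨g, hg, hnet⟩ := exists_measurable_netOutput_eq d z hi.le
  simp only [hnet]
  let S : Finset (Σ l : Fin d, Fin (n (l + 1)) × Fin (n l)) :=
    Finset.univ.filter fun p => (p.1 : ℕ) < i
  let T : Finset (Σ l : Fin d, Fin (n (l + 1)) × Fin (n l)) :=
    Finset.univ.filter fun p => (p.1 : ℕ) = i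
  let φ (x : S → ℝ) : Fin (n i) → ℝ := g fun p => x ⟨p.1, by simpa [S] using p.2⟩
  let ψ (x : T → ℝ) (a : Fin (n (i + 1))) (b : Fin (n i)) : ℝ := x ⟨⟨⟨i, hi⟩, a, b⟩, by simp [T]⟩
  have hindep := (hW.2.indepFun_finset₀ S T
    (Finset.disjoint_filter.2 fun p _ hlt heq => hlt.ne heq) hentry).comp
    (φ := φ) (ψ := ψ) (hg.comp (by fun_prop)) (by fun_prop)
  have hlaw : HasLaw (fun ω => g fun p => W p.1.1 ω p.1.2.1 p.1.2.2) _ μ :=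
    ⟨hg.comp_aemeasurable (aemeasurable_pi_lambda _ fun p => hentry p.1), rfl⟩
  exact IndepFun.hasLaw_prod hlaw (hW.hasLaw_rows hi Function.injective_id) hindep

theorem IsIIDStdGaussian.measure_card_activeRows_lt_le (hW : IsIIDStdGaussian μ d n W)
    (hi : i < d) (z : Fin (n 0) → ℝ) {m : ℕ} (hm : 5 * m ≤ 2 * n (i + 1)) :
    μ {ω | netOutput n (fun i => W i ω) z i ≠ 0 ∧
        (activeRows (W i ω) (netOutput n (fun i => W i ω) z i)).card < m} ≤
      ENNReal.ofReal ((99 / 100) ^ n (i + 1)) := by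
  let B : Set ((Fin (n i) → ℝ) × (Fin (n (i + 1)) → Fin (n i) → ℝ)) :=
    {q | q.1 ≠ 0 ∧ (activeRows (Matrix.of q.2) q.1).card < m}
  have hB : MeasurableSet B := (measurableSet_eq_fun measurable_fst measurable_const).compl.inter
    (measurableSet_card_activeRows_lt m)
  have hlaw := hW.hasLaw_netOutput_prodMk hi z
  have hprob : IsProbabilityMeasure (μ.map fun ω => netOutput n (fun i => W i ω) z i) :=
    Measure.isProbabilityMeasure_map (measurable_fst.comp_aemeasurable hlaw.aemeasurable)
  refine (Measure.le_map_apply hlaw.aemeasurable B).trans ?_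
  rw [hlaw.map_eq]
  refine prod_le_of_forall_section_le _ _ hB fun y => ?_
  by_cases hy : y = 0
  · simp [B, hy]
  · have hcount := pi_gaussianRow_card_activeRows_lt_le (J := Fin (n (i + 1)))
      (by simpa using hm) hy
    rw [Fintype.card_fin] at hcount
    exact (measure_mono fun _ hV => hV.2).trans hcount

end Law

/-- The constant `c₂` of the theorem. Its exponent `12` makes
`c₂ ^ (m - n i) ≤ (1 / 100) ^ n (i + 1)` for `m = 2 * n (i + 1) / 5`, which beats the number of
submatrices with `m` rows. -/
noncomputable abbrev extensionConstant : ℝ := (1 / 100) ^ 12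

section Extension

variable {Ω : Type*} [MeasurableSpace Ω] {μ : Measure Ω} {d : ℕ} {n : ℕ → ℕ}
  {W : (i : ℕ) → Ω → Matrix (Fin (n (i + 1))) (Fin (n i)) ℝ} {i : ℕ}

theorem RowsExtend.mono {N k : ℕ} {A : Matrix (Fin N) (Fin k) ℝ} {I I' : Finset (Fin N)} {c : ℝ}
    (h : RowsExtend A I c) (hI : I ⊆ I') : RowsExtend A I' c := fun x =>
  (h x).trans ((pi_norm_le_iff_of_nonneg (norm_nonneg _)).2 fun j =>
    norm_le_pi_norm ((A.submatrix (fun j : I' => (j : Fin N)) id).mulVec x) ⟨j, hI j.2⟩)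

theorem two_mul_natCast_le_four_pow (k : ℕ) : (2 * k : ℝ) ≤ 4 ^ k := by
  have hbernoulli := one_add_mul_le_pow (a := (3 : ℝ)) (by norm_num) k
  norm_num at hbernoulli
  linarith [k.cast_nonneg (α := ℝ)]

theorem IsIIDStdGaussian.eachSubmatrixExtends (hW : IsIIDStdGaussian μ d n W) (hi : i < d) :
    EachSubmatrixExtends μ (W i) (2 * n i) extensionConstant ((99 / 100) ^ n i) := by
  intro I hI
  obtain ⟨I', hI'I, hI'⟩ := Finset.exists_subset_card_eq hI
  have hsubset : {ω | ¬ RowsExtend (W i ω) I extensionConstant} ⊆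
      {ω | ¬ RowsExtend (W i ω) I' extensionConstant} := fun ω hω h => hω (h.mono hI'I)
  refine (measure_mono hsubset).trans
    ((hW.measure_not_rowsExtend_le hi I' (by norm_num) (by norm_num)).trans
      (ENNReal.ofReal_le_ofReal ?_))
  rw [hI', show 2 * n i - n i = n i by omega, pow_mul]
  calc (2 * n i : ℝ) * ((4 ^ 2) ^ n i * extensionConstant ^ n i)
      ≤ 4 ^ n i * ((4 ^ 2) ^ n i * extensionConstant ^ n i) := by
        gcongr
        exact two_mul_natCast_le_four_pow _
    _ = (4 * (4 ^ 2 * extensionConstant)) ^ n i := by rw [mul_pow, mul_pow]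
    _ ≤ _ := pow_le_pow_left₀ (by positivity) (by norm_num) _

theorem choose_mul_extensionConstant_pow_le {k m N : ℕ} (hkm : k ≤ m) (hmN : m ≤ N)
    (hN : N ≤ 12 * (m - k)) :
    (N.choose m : ℝ) * (2 * k * (4 ^ m * extensionConstant ^ (m - k))) ≤ (99 / 100) ^ N := by
  have hchoose : (N.choose m : ℝ) ≤ 2 ^ N := by exact_mod_cast N.choose_le_two_pow m
  have hk : (2 * k : ℝ) ≤ 4 ^ N :=
    (two_mul_natCast_le_four_pow k).trans (pow_le_pow_right₀ (by norm_num) (hkm.trans hmN))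
  have h4 : (4 : ℝ) ^ m ≤ 4 ^ N := pow_le_pow_right₀ (by norm_num) hmN
  have hc : extensionConstant ^ (m - k) ≤ (1 / 100) ^ N := by
    rw [← pow_mul]
    exact pow_le_pow_of_le_one (by norm_num) (by norm_num) hN
  calc _ ≤ (2 : ℝ) ^ N * (4 ^ N * (4 ^ N * (1 / 100) ^ N)) := by gcongr
    _ = (2 * (4 * (4 * (1 / 100)))) ^ N := by simp only [mul_pow]
    _ ≤ _ := pow_le_pow_left₀ (by positivity) (by norm_num) _

theorem IsIIDStdGaussian.allSubmatricesExtend (hW : IsIIDStdGaussian μ d n W) (hi : i < d) {m : ℕ}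
    (hnm : n i ≤ m) (hm : m ≤ n (i + 1)) (hn : n (i + 1) ≤ 12 * (m - n i)) :
    AllSubmatricesExtend μ (W i) m extensionConstant ((99 / 100) ^ n (i + 1)) := by
  have hsubset : {ω | ¬ ∀ I : Finset (Fin (n (i + 1))), m ≤ I.card →
        RowsExtend (W i ω) I extensionConstant} ⊆
      ⋃ I ∈ Finset.powersetCard m Finset.univ,
        {ω | ¬ RowsExtend (W i ω) I extensionConstant} := by
    intro ω hω
    simp only [Set.mem_ofPred_eq, not_forall] at hω
    obtain ⟨I, hI, hnot⟩ := hω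
    obtain ⟨I', hI'I, hI'⟩ := Finset.exists_subset_card_eq hI
    exact Set.mem_biUnion (Finset.mem_powersetCard_univ.2 hI') fun h => hnot (h.mono hI'I)
  have hterm (I : Finset (Fin (n (i + 1)))) (hI : I ∈ Finset.powersetCard m Finset.univ) :
      μ {ω | ¬ RowsExtend (W i ω) I extensionConstant} ≤
        ENNReal.ofReal (2 * n i * (4 ^ m * extensionConstant ^ (m - n i))) := by
    rw [← Finset.mem_powersetCard_univ.1 hI]
    exact hW.measure_not_rowsExtend_le hi I (by norm_num) (by norm_num)
  refine (measure_mono hsubset).trans ((measure_biUnion_finset_le _ _).trans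
    ((Finset.sum_le_card_nsmul _ _ _ hterm).trans ?_))
  rw [Finset.card_powersetCard, Finset.card_univ, Fintype.card_fin, nsmul_eq_mul,
    ← ENNReal.ofReal_natCast, ← ENNReal.ofReal_mul (by positivity)]
  exact ENNReal.ofReal_le_ofReal (choose_mul_extensionConstant_pow_le hnm hm hn)

theorem IsIIDStdGaussian.measure_not_relaxedPolyhedron_subset_le (hW : IsIIDStdGaussian μ d n W)
    (hd : 0 < d) (hn : 5 * n 0 ≤ n 1) {b : Fin (n 0) → ℝ} (hb : ‖WithLp.toLp 2 b‖ ≤ 1000) :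
    μ {ω | ¬ relaxedPolyhedron (W 0 ω) b ⊆ Metric.closedBall 0 feasibleRadius} ≤
      ENNReal.ofReal (40 * (99 / 100) ^ n 0) := by
  have hfeasible := pi_gaussianRow_exists_feasible_le (J := Fin (n 1)) hb
  rw [Fintype.card_fin, Fintype.card_fin] at hfeasible
  refine ((measure_mono fun ω hω => ?_).trans
    ((hW.measure_rows_mem_le hd Function.injective_id _).trans hfeasible)).trans
    (ENNReal.ofReal_le_ofReal ?_)
  · obtain ⟨v, hv, hlarge⟩ := Set.not_subset.1 hω
    rw [mem_closedBall_zero_iff, not_le] at hlarge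
    exact ⟨v, hlarge.le, hv⟩
  · have hk : (n 0 : ℝ) ≤ 20 * (21 / 20) ^ n 0 := by
      have hbernoulli := one_add_mul_le_pow (a := (1 / 20 : ℝ)) (by norm_num) (n 0)
      norm_num at hbernoulli
      linarith
    have hpow : (129 / 200 : ℝ) ^ n 1 ≤ ((129 / 200) ^ 5) ^ n 0 := by
      rw [← pow_mul]
      exact pow_le_pow_of_le_one (by norm_num) (by norm_num) hn
    calc (2 : ℝ) * n 0 * (8 ^ n 0 * (129 / 200) ^ n 1)
        ≤ 2 * (20 * (21 / 20) ^ n 0) * (8 ^ n 0 * ((129 / 200) ^ 5) ^ n 0) := by gcongr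
      _ = 40 * ((21 / 20) * (8 * (129 / 200) ^ 5)) ^ n 0 := by simp only [mul_pow]; ring
      _ ≤ _ := by gcongr; norm_num

end Extension

section Recovery

variable {n : ℕ → ℕ} {d : ℕ}

theorem add_le_layer_width (hn₀ : 0 < n 0) (hn : ∀ i < d, 5 * n i ≤ n (i + 1)) {i : ℕ}
    (hi : i ≤ d) : n 0 + i ≤ n i := by
  induction i with
  | zero => exact le_rfl
  | succ i ih =>
    have := ih (by omega)
    have := hn i (by omega)
    omega

theorem sum_pow_layer_width_le (hn₀ : 0 < n 0) (hn : ∀ i < d, 5 * n i ≤ n (i + 1)) :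
    ∑ i ∈ Finset.range d, (99 / 100 : ℝ) ^ n (i + 1) ≤ 100 * (99 / 100) ^ n 0 := by
  calc ∑ i ∈ Finset.range d, (99 / 100 : ℝ) ^ n (i + 1)
      ≤ ∑ i ∈ Finset.range d, (99 / 100 : ℝ) ^ n 0 * (99 / 100) ^ i := by
        refine Finset.sum_le_sum fun i hi => ?_
        have hwidth := add_le_layer_width hn₀ hn (i := i + 1) (Finset.mem_range.1 hi)
        rw [← pow_add]
        exact pow_le_pow_of_le_one (by norm_num) (by norm_num) (by omega)
    _ = (∑ i ∈ Finset.range d, (99 / 100 : ℝ) ^ i) * (99 / 100 : ℝ) ^ n 0 := by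
        rw [← Finset.mul_sum, mul_comm]
    _ ≤ 100 * (99 / 100 : ℝ) ^ n 0 := by
        gcongr
        rw [geom_sum_eq (by norm_num)]
        have hnonneg : (0 : ℝ) ≤ (99 / 100) ^ d := by positivity
        rw [div_le_iff_of_neg (by norm_num)]
        linarith

variable {Ω : Type*} [MeasurableSpace Ω] {μ : Measure Ω} [IsProbabilityMeasure μ]
  {W : (i : ℕ) → Ω → Matrix (Fin (n (i + 1))) (Fin (n i)) ℝ}

theorem IsIIDStdGaussian.measure_not_isGoodLayer_le (hW : IsIIDStdGaussian μ d n W) {i m : ℕ}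
    (hi : i < d) (hnm : n i ≤ m) (hm : 5 * m ≤ 2 * n (i + 1))
    (hn : n (i + 1) ≤ 12 * (m - n i)) (z : Fin (n 0) → ℝ) :
    μ {ω | ¬ IsGoodLayer (W i ω) (netOutput n (fun i => W i ω) z i) m extensionConstant} ≤
      ENNReal.ofReal (2 * (99 / 100) ^ n (i + 1)) := by
  refine (measure_mono fun ω hω => ?_).trans ((measure_union_le _ _).trans
    ((add_le_add (hW.allSubmatricesExtend hi hnm (by omega) hn)
      (hW.measure_card_activeRows_lt_le hi z hm)).trans_eq ?_))
  · by_contra hgood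
    simp only [Set.mem_union, Set.mem_ofPred_eq, not_or, not_not, not_and, not_lt] at hgood
    exact hω ⟨hgood.1, hgood.2⟩
  · rw [← ENNReal.ofReal_add (by positivity) (by positivity), two_mul]

theorem IsIIDStdGaussian.measure_exists_not_isGoodLayer_le (hW : IsIIDStdGaussian μ d n W)
    (hn₀ : 0 < n 0) (hn : ∀ i < d, 5 * n i ≤ n (i + 1)) (z : Fin (n 0) → ℝ) :
    μ {ω | ∃ i < d, ¬ IsGoodLayer (W i ω) (netOutput n (fun i => W i ω) z i)
        (2 * n (i + 1) / 5) extensionConstant} ≤ ENNReal.ofReal (200 * (99 / 100) ^ n 0) := by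
  have hlayer (i : ℕ) (hi : i ∈ Finset.range d) :
      μ {ω | ¬ IsGoodLayer (W i ω) (netOutput n (fun i => W i ω) z i) (2 * n (i + 1) / 5)
        extensionConstant} ≤ ENNReal.ofReal (2 * (99 / 100) ^ n (i + 1)) := by
    have hid := Finset.mem_range.1 hi
    have hwidth := add_le_layer_width hn₀ hn hid.le
    have hratio := hn i hid
    exact hW.measure_not_isGoodLayer_le hid (by omega) (by omega) (by omega) z
  have hsubset : {ω | ∃ i < d, ¬ IsGoodLayer (W i ω) (netOutput n (fun i => W i ω) z i)
        (2 * n (i + 1) / 5) extensionConstant} ⊆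
      ⋃ i ∈ Finset.range d, {ω | ¬ IsGoodLayer (W i ω) (netOutput n (fun i => W i ω) z i)
        (2 * n (i + 1) / 5) extensionConstant} :=
    fun _ ⟨_, hi, hω⟩ => Set.mem_biUnion (Finset.mem_range.2 hi) hω
  refine (measure_mono hsubset).trans
    ((measure_biUnion_finset_le (Finset.range d) _).trans ((Finset.sum_le_sum hlayer).trans ?_))
  rw [← ENNReal.ofReal_sum_of_nonneg fun _ _ => by positivity, ← Finset.mul_sum]
  exact ENNReal.ofReal_le_ofReal (by linarith [sum_pow_layer_width_le hn₀ hn])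

theorem IsIIDStdGaussian.measure_not_inversionRecovers_le (hW : IsIIDStdGaussian μ d n W)
    (hn₀ : 0 < n 0) (hn : ∀ i < d, 5 * n i ≤ n (i + 1)) (z : Fin (n 0) → ℝ) :
    μ {ω | ¬ ∀ e : Fin (n d) → ℝ,
        ‖e‖ < extensionConstant ^ d / 2 ^ (d + 4) * ‖WithLp.toLp 2 z‖ * √(n 0) →
        InversionRecovers n (fun i => W i ω) d (netOutput n (fun i => W i ω) z d + e)
          (fun i => ‖e‖ * (2 / extensionConstant) ^ (d - i)) z
          (2 ^ d * ‖e‖ / extensionConstant ^ d)} ≤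
      ENNReal.ofReal (240 * (99 / 100) ^ n 0) := by
  rcases eq_or_ne z 0 with rfl | hz
  · simp [(norm_nonneg _).not_gt]
  have hzpos : 0 < ‖WithLp.toLp 2 z‖ := norm_pos_iff.2 (by simpa using hz)
  set b := (1000 / ‖WithLp.toLp 2 z‖) • z with hb
  have hbnorm : ‖WithLp.toLp 2 b‖ ≤ 1000 := by
    rw [hb, WithLp.toLp_smul, norm_smul, Real.norm_of_nonneg (by positivity),
      div_mul_cancel₀ _ hzpos.ne']
  have hbounded : μ {ω | 0 < d ∧
      ¬ relaxedPolyhedron (W 0 ω) b ⊆ Metric.closedBall 0 feasibleRadius} ≤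
        ENNReal.ofReal (40 * (99 / 100) ^ n 0) := by
    rcases d.eq_zero_or_pos with rfl | hd
    · simp
    · exact (measure_mono fun ω hω => hω.2).trans
        (hW.measure_not_relaxedPolyhedron_subset_le hd (hn 0 hd) hbnorm)
  refine (measure_mono fun ω hω => ?_).trans ((measure_union_le _ _).trans ((add_le_add
    (hW.measure_exists_not_isGoodLayer_le hn₀ hn z) hbounded).trans_eq ?_))
  · by_contra hgood
    simp only [Set.mem_union, Set.mem_ofPred_eq, not_or, not_exists, not_and, not_not] at hgood
    refine hω fun e he => inversionRecovers_of_isGoodLayer (by norm_num) (by norm_num)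
      (by norm_num [feasibleRadius]) (fun i hi => ?_) (fun i hi => ?_) hz hgood.1 hgood.2 he
    · have := add_le_layer_width hn₀ hn hi
      omega
    · have := hn i hi
      omega
  · rw [← ENNReal.ofReal_add (by positivity) (by positivity)]
    ring_nf

end Recovery

theorem pow_le_exp_neg (k : ℕ) : (99 / 100 : ℝ) ^ k ≤ Real.exp (-(1 / 100) * k) := by
  rw [mul_comm, Real.exp_nat_mul]
  refine pow_le_pow_left₀ (by norm_num) ?_ k
  linarith [Real.one_sub_le_exp_neg (1 / 100)]

theorem corollary1 :
    ∃ c₂ C γ : ℝ, 0 < c₂ ∧ c₂ ≤ 2 ∧ 0 < C ∧ 0 < γ ∧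
      ∀ (d : ℕ) (n : ℕ → ℕ), 0 < n 0 → (∀ i < d, 5 * n i ≤ n (i + 1)) →
      ∀ (Ω : Type*) [MeasurableSpace Ω] (μ : Measure Ω) [IsProbabilityMeasure μ]
        (W : (i : ℕ) → Ω → Matrix (Fin (n (i + 1))) (Fin (n i)) ℝ),
        IsIIDStdGaussian μ d n W →
        (∀ i < d,
          (∃ m : ℕ, n i < m ∧ 5 * m ≤ 2 * n (i + 1) ∧
            AllSubmatricesExtend μ (W i) m c₂ (C * Real.exp (-γ * n i))) ∧
          EachSubmatrixExtends μ (W i) (2 * n i) c₂ (C * Real.exp (-γ * n i))) ∧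
        ∀ zstar : Fin (n 0) → ℝ,
          μ {ω | ¬ ∀ e : Fin (n d) → ℝ,
              ‖e‖ < c₂ ^ d / 2 ^ (d + 4) * ‖WithLp.toLp 2 zstar‖ * √(n 0) →
              InversionRecovers n (fun i => W i ω) d
                (netOutput n (fun i => W i ω) zstar d + e)
                (fun i => ‖e‖ * (2 / c₂) ^ (d - i)) zstar
                (2 ^ d * ‖e‖ / c₂ ^ d)} ≤
            ENNReal.ofReal (C * Real.exp (-γ * n 0)) := by
  refine ⟨extensionConstant, 240, 1 / 100, by norm_num, by norm_num, by norm_num, by norm_num, ?_⟩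
  intro d n hn₀ hn Ω _ μ _ W hW
  have hexp (k : ℕ) : (99 / 100 : ℝ) ^ k ≤ 240 * Real.exp (-(1 / 100) * k) := by
    linarith [pow_le_exp_neg k, Real.exp_nonneg (-(1 / 100) * (k : ℝ))]
  refine ⟨fun i hi => ?_, fun zstar => ?_⟩
  · have hpos := add_le_layer_width hn₀ hn hi.le
    have hratio := hn i hi
    refine ⟨⟨2 * n (i + 1) / 5, by omega, by omega, ?_⟩, fun I hI => ?_⟩
    · refine (hW.allSubmatricesExtend hi (by omega) (by omega) (by omega)).trans
        (ENNReal.ofReal_le_ofReal (le_trans ?_ (hexp (n i))))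
      exact pow_le_pow_of_le_one (by norm_num) (by norm_num) (by omega)
    · exact (hW.eachSubmatrixExtends hi I hI).trans (ENNReal.ofReal_le_ofReal (hexp (n i)))
  · exact (hW.measure_not_inversionRecovers_le hn₀ hn zstar).trans
      (ENNReal.ofReal_le_ofReal (by gcongr; exact pow_le_exp_neg _))
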